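/- All rings are associative and unital, not necessarily commutative. A \emph{complete local ring} $(R,\mathfrak m)$ is a ring $R$ with a unique maximal two-sided ideal $\mathfrak m$, such that $R/\mathfrak m$ is (simple) artinian and $R$ is separated and complete in the $\mathfrak m$-adic topology. A \emph{local skew derivation} of $(R,\mathfrak m)$ is a pair $(\sigma,\delta)$, where $\sigma$ is a ring automorphism of $R$ and $\delta:R\to R$ is an additive map with $\delta(ab)=\delta(a)b+\sigma(a)\delta(b)$ for all $a,b\in R$, such that $\sigma(\mathfrak m)\subseteq\mathfrak m$, $\delta(R)\subseteq\mathfrak m$ and $\delta(\mathfrak m)\subseteq\mathfrak m^2$. The \emph{local skew power series ring} $S=R[[x;\sigma,\delta]]$ is the ring of formal power series $\sum_{n\ge 0} r_nx^n$ ($r_n\in R$) whose multiplication extends that of $R$, satisfies $xa=\sigma(a)x+\delta(a)$ for $a\in R$, and is extended to infinite series termwise, the coefficients of a product being $\mathfrak m$-adically convergent sums. We write $S\in\mathbf{SPS}(R)$ if $S$ is such a ring for some local skew derivation $(\sigma,\delta)$ of $(R,\mathfrak m)$. \textbf{Theorem.} Let $(R,\mathfrak m)$ be a left noetherian complete local ring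 and let $S\in\mathbf{SPS}(R)$. Then, for every left $S$-module $M$ that is finitely generated as a left $R$-module and for every integer $i$, $$\mathrm{Ext}^i_R(M,R)\;\cong\;\mathrm{Ext}^{i+1}_S(M,S)$$ as abelian groups, where $\mathrm{Ext}^j=0$ for $j<0$ (so that the case $i=-1$ says $\mathrm{Hom}_S(M,S)=0$). -/

import Mathlib

universe u

/-- The two-sided ideal `m` is maximal among the proper two-sided ideals of `R`. -/
def IsMaximalTwoSided {R : Type u} [Ring R] (m : Ideal R) : Prop :=
  m.IsTwoSided ∧ m ≠ ⊤ ∧ ∀ J : Ideal R, J.IsTwoSided → m < J → J = ⊤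

/-- `(R, m)` is a (not necessarily commutative) complete local ring: `m` is the unique maximal
two-sided ideal of `R`, the (simple) residue ring `R ⧸ m` is artinian, and `R` is separated and
complete for the `m`-adic topology. -/
structure IsCompleteLocal {R : Type u} [Ring R] (m : Ideal R) [m.IsTwoSided] : Prop where
  isMaximal : IsMaximalTwoSided m
  unique : ∀ J : Ideal R, IsMaximalTwoSided J → J = m
  artinian : IsArtinianRing (R ⧸ m)
  separated : ∀ r : R, (∀ n : ℕ, r ∈ m ^ n) → r = 0
  complete : ∀ f : ℕ → R, (∀ n : ℕ, f (n + 1) - f n ∈ m ^ n) →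
    ∃ r : R, ∀ n : ℕ, f n - r ∈ m ^ n

/-- The series `∑ f n` converges to `a` in the `m`-adic topology. -/
def HasAdicSum {R : Type u} [Ring R] (m : Ideal R) (f : ℕ → R) (a : R) : Prop :=
  ∀ N : ℕ, ∃ n₀ : ℕ, ∀ n : ℕ, n₀ ≤ n → (∑ i ∈ Finset.range n, f i) - a ∈ m ^ N

/-- A local skew derivation `(σ, δ)` of `(R, m)`: an automorphism `σ` and a left `σ`-derivation
`δ` of `R` with `σ(m) ⊆ m`, `δ(R) ⊆ m` and `δ(m) ⊆ m ^ 2`. -/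
structure LocalSkewDerivation {R : Type u} [Ring R] (m : Ideal R) where
  σ : R ≃+* R
  δ : R →+ R
  δ_mul : ∀ a b : R, δ (a * b) = δ a * b + σ a * δ b
  σ_mem : ∀ a ∈ m, σ a ∈ m
  δ_mem : ∀ a : R, δ a ∈ m
  δ_mem_sq : ∀ a ∈ m, δ a ∈ m ^ 2

/-- The structure of a local skew power series ring `R[[x; σ, δ]]` over `(R, m)` on a ring `S`.

The elements of `S` are the formal power series `∑ r_n x ^ n` with coefficients on the left
(`coeff` is the bijection with sequences of coefficients), the multiplication extends that of `R`
and obeys the rule `x a = σ(a) x + δ(a)`, and it is extended to infinite series termwise: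
`(∑ s_n x ^ n) (∑ t_i x ^ i) = ∑ s_n x ^ n t_i x ^ i`. As `x ^ n t_i x ^ i` involves only powers
`x ^ k` with `k ≥ i`, the coefficient of `x ^ k` on the right is `m`-adically the sum over all `n`
of the finite sums over `i ≤ k`. -/
structure LocalSkewPowerSeriesRing {R : Type u} [Ring R] (m : Ideal R) (S : Type u) [Ring S]
    extends LocalSkewDerivation m where
  /-- the inclusion of the constants -/
  C : R →+* S
  /-- the variable -/
  X : S
  coeff : S ≃+ (ℕ → R)
  coeff_C_mul_X_pow : ∀ (r : R) (n : ℕ), coeff (C r * X ^ n) = Pi.single n r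
  X_mul_C : ∀ a : R, X * C a = C (σ a) * X + C (δ a)
  coeff_mul : ∀ (s t : S) (k : ℕ),
    HasAdicSum m
      (fun n => ∑ i ∈ Finset.range (k + 1),
        coeff (C (coeff s n) * X ^ n * (C (coeff t i) * X ^ i)) k)
      (coeff (s * t) k)

-- The variable acts on a module `M` finite over `R` as the root of a Weierstrass polynomial. As `X`
-- lies in the Jacobson radical of `S`, Nakayama over the artinian quotient of `M` by the series
-- with coefficients in `m` gives a power of `X` carrying `M` into the submodule generated by these
-- series. Hence `M` has finitely many `R`-generators on which `X` acts by a matrix `A` over `R`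
-- that is nilpotent modulo `m` (`exists_weighted_generators`), and `M` is a quotient of `F = S^ι /
-- S^ι (X - A)`.
--
-- Weierstrass division by `X - A`, solved as a contracting fixed-point problem, does two things.
-- For rows it shows that `0 → S^ι → S^ι → F → 0` is exact and that `F` is free over `R` on `ι`. For
-- columns it shows that the dual map on `S^ι` is injective with the constants `R^ι` as a complement
-- of its image. So `Ext_S(F, S)` is concentrated in degree one, where it is `R^ι`, that is,
-- `Hom_R(F, R)`. The identification becomes natural after a twist by `σ`: a map with matrix `G` on
-- the bases lifts to `σ(G)` on the first terms of the resolutions.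
--
-- Since `R` is noetherian, kernels of `F → M` are again finite over `R`, and `M` has a presentation
-- by such modules. `Hom_S(M, S) = 0` follows from the surjection, which makes `Ext¹_S(-, S)` left
-- exact on these modules; comparing kernels gives degree zero, comparing cokernels degree one, and
-- dimension shifting the rest.

universe v

set_option linter.unusedSectionVars false

/-! ### Fixed points of contracting maps, and the `m`-adic filtration. -/

section Filtration

variable {R : Type u} [Ring R] {m : Ideal R} [m.IsTwoSided]

theorem Ideal.mul_mem_pow_add {a b : R} {i j : ℕ} (ha : a ∈ m ^ i) (hb : b ∈ m ^ j) :
    a * b ∈ m ^ (i + j) := by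
  rw [Ideal.IsTwoSided.pow_add]
  exact Ideal.mul_mem_mul ha hb

theorem Ideal.mem_pow_zero (a : R) : a ∈ m ^ 0 := by
  rw [Submodule.pow_zero, Ideal.one_eq_top]; trivial

/-- Induction on the membership of a power of an ideal. -/
theorem Ideal.pow_succ_induction {j : ℕ} {p : R → Prop} {a : R} (ha : a ∈ m ^ (j + 1))
    (hmul : ∀ x ∈ m ^ j, ∀ y ∈ m, p (x * y)) (hadd : ∀ x y, p x → p y → p (x + y)) : p a := by
  rw [Submodule.pow_succ] at ha
  exact Submodule.smul_induction_on ha hmul hadd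

theorem sub_mem_filtration_of_succ {G : Type*} [AddCommGroup G] (w : ℕ → G)
    (F : ℕ → G → Prop) (hanti : ∀ t x, F (t + 1) x → F t x) (hzero : ∀ t, F t 0)
    (hadd : ∀ t x y, F t x → F t y → F t (x + y))
    (hw : ∀ t, F t (w (t + 1) - w t)) (t s : ℕ) : F t (w (t + s) - w t) := by
  have anti : ∀ a t x, F (t + a) x → F t x := by
    intro a
    induction a with
    | zero => intro t x h; exact h
    | succ a ih => intro t x h; exact ih t x (hanti _ x h)
  induction s with
  | zero => simpa using hzero t
  | succ s ih =>
    have := hadd t _ _ ih (anti s t _ (hw (t + s)))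
    simpa [← add_assoc] using this

namespace IsCompleteLocal

theorem eq_of_forall_sub_mem (hR : IsCompleteLocal m) {a b : R} (h : ∀ n, a - b ∈ m ^ n) :
    a = b :=
  sub_eq_zero.1 (hR.separated _ h)

variable {κ : Type*} (e : ℕ → κ → ℕ)

/-- A map that is contracting for a filtration of `κ → R` by powers of `m` has at most one fixed
point. -/
theorem eq_zero_of_contracting (hR : IsCompleteLocal m)
    (htend : ∀ p N, ∃ t, N ≤ e t p) (he0 : ∀ p, e 0 p = 0) (Φ : (κ → R) →+ (κ → R))
    (hΦ : ∀ t w, (∀ p, w p ∈ m ^ e t p) → ∀ p, Φ w p ∈ m ^ e (t + 1) p)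
    (w : κ → R) (hw : Φ w = w) : w = 0 := by
  have h : ∀ t p, w p ∈ m ^ e t p := by
    intro t
    induction t with
    | zero => intro p; rw [he0]; exact Ideal.mem_pow_zero _
    | succ t ih => intro p; rw [← hw]; exact hΦ t w ih p
  funext p
  refine hR.separated _ fun N => ?_
  obtain ⟨t, ht⟩ := htend p N
  exact Ideal.pow_le_pow_right ht (h t p)

/-- For a contracting map `Φ` of `κ → R` the equation `w = v + Φ w` has a solution. -/
theorem exists_eq_add_of_contracting (hR : IsCompleteLocal m) (hmono : ∀ p, Monotone (e · p))
    (htend : ∀ p N, ∃ t, N ≤ e t p) (Φ : (κ → R) →+ (κ → R))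
    (hΦ : ∀ t w, (∀ p, w p ∈ m ^ e t p) → ∀ p, Φ w p ∈ m ^ e (t + 1) p)
    (v : κ → R) (hv : ∀ p, v p ∈ m ^ e 0 p) :
    ∃ w : κ → R, (∀ p, w p ∈ m ^ e 0 p) ∧ w = v + Φ w := by
  -- Picard iteration from `0`: consecutive iterates differ by the images of `v` under powers of
  -- `Φ`.
  let f : ℕ → κ → R := fun t => Nat.rec 0 (fun _ w => v + Φ w) t
  have f_succ : ∀ t, f (t + 1) = v + Φ (f t) := fun t => rfl
  have step : ∀ t p, (f (t + 1) - f t) p ∈ m ^ e t p := by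
    intro t
    induction t with
    | zero => intro p; simpa [f] using hv p
    | succ t ih =>
      intro p
      have : f (t + 1 + 1) - f (t + 1) = Φ (f (t + 1) - f t) := by
        rw [f_succ (t + 1), f_succ t, map_sub]; simp
      rw [this]
      exact hΦ t _ ih p
  have diff : ∀ t s p, (f (t + s) - f t) p ∈ m ^ e t p := by
    intro t s p
    exact sub_mem_filtration_of_succ f (fun t x => x p ∈ m ^ e t p)
      (fun t x h => Ideal.pow_le_pow_right (hmono p t.le_succ) h)
      (fun t => (m ^ e t p).zero_mem) (fun t x y hx hy => (m ^ e t p).add_mem hx hy)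
      (fun t => step t p) t s
  have diff' : ∀ a b p N, N ≤ e a p → N ≤ e b p → f a p - f b p ∈ m ^ N := by
    intro a b p N ha hb
    rcases le_total a b with h | h
    · obtain ⟨s, rfl⟩ := Nat.exists_eq_add_of_le h
      have := (m ^ N).neg_mem (Ideal.pow_le_pow_right ha (diff a s p))
      simpa using this
    · obtain ⟨s, rfl⟩ := Nat.exists_eq_add_of_le h
      simpa using Ideal.pow_le_pow_right hb (diff b s p)
  have lim : ∀ p, ∃ r : R, ∀ t, f t p - r ∈ m ^ e t p := by
    intro p
    -- Completeness speaks of sequences indexed by the exponent, whereas `e t p` may stay constant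
    -- for many `t`; hence the subsequence `τ N` along which the exponent at `p` has reached `N`.
    choose τ hτ using htend p
    obtain ⟨r, hr⟩ := hR.complete (fun N => f (τ N) p) (fun N =>
      diff' _ _ p N (N.le_succ.trans (hτ (N + 1))) (hτ N))
    refine ⟨r, fun t => ?_⟩
    have := (m ^ e t p).add_mem (diff' t (τ (e t p)) p _ le_rfl (hτ _)) (hr (e t p))
    simpa using this
  choose w hw using lim
  refine ⟨w, fun p => ?_, ?_⟩
  · have := (m ^ e 0 p).neg_mem (hw p 0)
    simpa [f] using this
  · funext p
    refine hR.eq_of_forall_sub_mem fun N => ?_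
    obtain ⟨t, ht⟩ := htend p N
    have h1 := (m ^ e (t + 1) p).neg_mem (hw p (t + 1))
    have h2 := hΦ t (f t - w) (fun q => hw q t) p
    have h3 := (m ^ e (t + 1) p).add_mem h1 h2
    refine Ideal.pow_le_pow_right (ht.trans (hmono p t.le_succ)) ?_
    convert h3 using 1
    rw [f_succ, map_sub]
    simp only [Pi.add_apply, Pi.sub_apply]
    abel

end IsCompleteLocal

namespace LocalSkewDerivation

variable (D : LocalSkewDerivation m)

theorem σ_mem_pow {j : ℕ} {a : R} (ha : a ∈ m ^ j) : D.σ a ∈ m ^ j := by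
  induction j generalizing a with
  | zero => exact Ideal.mem_pow_zero _
  | succ j ih =>
    refine Ideal.pow_succ_induction (p := fun a => D.σ a ∈ m ^ (j + 1)) ha ?_ ?_
    · intro x hx y hy
      rw [map_mul, Submodule.pow_succ]
      exact Ideal.mul_mem_mul (ih hx) (D.σ_mem y hy)
    · intro x y hx hy
      rw [map_add]
      exact add_mem hx hy

/-- Leibniz on `x * y` with `x ∈ m ^ j` and `y ∈ m`: the term `δ x * y` gains by induction, the term
`σ x * δ y` because `δ(m) ⊆ m ^ 2`. -/
theorem δ_mem_pow {j : ℕ} {a : R} (ha : a ∈ m ^ j) : D.δ a ∈ m ^ (j + 1) := by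
  induction j generalizing a with
  | zero => simpa [Submodule.pow_one] using D.δ_mem a
  | succ j ih =>
    refine Ideal.pow_succ_induction (p := fun a => D.δ a ∈ m ^ (j + 1 + 1)) ha ?_ ?_
    · intro x hx y hy
      rw [D.δ_mul]
      refine add_mem ?_ ?_
      · rw [Submodule.pow_succ]
        exact Ideal.mul_mem_mul (ih hx) hy
      · exact Ideal.mul_mem_pow_add (j := 2) (D.σ_mem_pow hx) (D.δ_mem_sq y hy)
    · intro x y hx hy
      rw [map_add]
      exact add_mem hx hy

/-- The preimage of `m` under `σ` is a proper two-sided ideal containing `m`, so it equals `m` by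
maximality. -/
theorem σ_symm_mem (hR : IsCompleteLocal m) {a : R} (ha : a ∈ m) : D.σ.symm a ∈ m := by
  let J : Ideal R :=
    { carrier := {x | D.σ x ∈ m}
      add_mem' := fun {x y} hx hy => by
        simp only [Set.mem_ofPred_eq, map_add] at *; exact add_mem hx hy
      zero_mem' := by simp
      smul_mem' := fun c x hx => by
        simp only [Set.mem_ofPred_eq, smul_eq_mul, map_mul] at *; exact m.mul_mem_left _ hx }
  have hJ : J.IsTwoSided := ⟨fun {x} b hx => by
    change D.σ (x * b) ∈ m
    rw [map_mul]
    exact m.mul_mem_right _ hx⟩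
  have hle : m ≤ J := fun x hx => D.σ_mem x hx
  have hne : J ≠ ⊤ := by
    intro h
    have h1 : D.σ 1 ∈ m := by
      have : (1 : R) ∈ J := h ▸ trivial
      exact this
    exact hR.isMaximal.2.1 ((Ideal.eq_top_iff_one m).2 (by simpa using h1))
  have heq : m = J := by
    by_contra hmJ
    exact hne (hR.isMaximal.2.2 J hJ (lt_of_le_of_ne hle hmJ))
  refine heq.ge (show D.σ (D.σ.symm a) ∈ m from ?_)
  simpa using ha

theorem σ_symm_mem_pow (hR : IsCompleteLocal m) {j : ℕ} {a : R} (ha : a ∈ m ^ j) :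
    D.σ.symm a ∈ m ^ j := by
  induction j generalizing a with
  | zero => exact Ideal.mem_pow_zero _
  | succ j ih =>
    refine Ideal.pow_succ_induction (p := fun a => D.σ.symm a ∈ m ^ (j + 1)) ha ?_ ?_
    · intro x hx y hy
      rw [map_mul, Submodule.pow_succ]
      exact Ideal.mul_mem_mul (ih hx) (D.σ_symm_mem hR hy)
    · intro x y hx hy
      rw [map_add]
      exact add_mem hx hy

end LocalSkewDerivation

end Filtration

theorem HasAdicSum.eq_sum_range {R : Type u} [Ring R] {m : Ideal R} [m.IsTwoSided]
    (hR : IsCompleteLocal m) {f : ℕ → R} {a : R} (h : HasAdicSum m f a) (N : ℕ)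
    (hf : ∀ n, N ≤ n → f n = 0) : a = ∑ i ∈ Finset.range N, f i := by
  symm
  refine hR.eq_of_forall_sub_mem fun j => ?_
  obtain ⟨n₀, hn₀⟩ := h j
  have := hn₀ (max n₀ N) (le_max_left _ _)
  rwa [← Finset.sum_subset (s₁ := Finset.range N)] at this
  · intro i hi
    simp only [Finset.mem_range] at *
    exact lt_max_of_lt_right hi
  · intro i _ hi
    exact hf i (by simpa using hi)

/-! ### Coefficients of products in the skew power series ring. -/

namespace LocalSkewPowerSeriesRing

variable {R S : Type u} [Ring R] [Ring S] {m : Ideal R} [m.IsTwoSided]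
  (P : LocalSkewPowerSeriesRing m S)

theorem ext_coeff {s t : S} (h : ∀ k, P.coeff s k = P.coeff t k) : s = t :=
  P.coeff.injective (funext h)

theorem coeff_C (r : R) : P.coeff (P.C r) = Pi.single 0 r := by
  simpa using P.coeff_C_mul_X_pow r 0

theorem coeff_X_pow (n : ℕ) : P.coeff (P.X ^ n) = Pi.single n 1 := by
  simpa using P.coeff_C_mul_X_pow 1 n

theorem coeff_X : P.coeff P.X = Pi.single 1 1 := by
  simpa using P.coeff_X_pow 1

theorem coeff_C_zero (r : R) : P.coeff (P.C r) 0 = r := by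
  rw [coeff_C, Pi.single_eq_same]

theorem coeff_C_succ (r : R) (k : ℕ) : P.coeff (P.C r) (k + 1) = 0 := by
  rw [coeff_C, Pi.single_eq_of_ne (by simp)]

theorem coeff_add (s t : S) (k : ℕ) : P.coeff (s + t) k = P.coeff s k + P.coeff t k := by
  rw [map_add, Pi.add_apply]

theorem coeff_sub (s t : S) (k : ℕ) : P.coeff (s - t) k = P.coeff s k - P.coeff t k := by
  rw [map_sub, Pi.sub_apply]

theorem coeff_zero (k : ℕ) : P.coeff 0 k = 0 := by
  rw [map_zero, Pi.zero_apply]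

theorem coeff_sum {ι : Type*} (s : Finset ι) (f : ι → S) (k : ℕ) :
    P.coeff (∑ i ∈ s, f i) k = ∑ i ∈ s, P.coeff (f i) k := by
  rw [map_sum, Finset.sum_apply]

theorem C_injective : Function.Injective P.C := fun a b h => by
  rw [← P.coeff_C_zero a, h, P.coeff_C_zero]

section

variable (hR : IsCompleteLocal m)

include hR

theorem coeff_C_mul (r : R) (s : S) (k : ℕ) : P.coeff (P.C r * s) k = r * P.coeff s k := by
  rw [(P.coeff_mul (P.C r) s k).eq_sum_range hR 1]
  · simp only [Finset.range_one, Finset.sum_singleton, coeff_C_zero, pow_zero, mul_one]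
    have : ∀ i, P.coeff (P.C r * (P.C (P.coeff s i) * P.X ^ i)) k =
        if i = k then r * P.coeff s k else 0 := by
      intro i
      rw [← mul_assoc, ← map_mul, coeff_C_mul_X_pow]
      by_cases h : i = k
      · subst h; simp
      · rw [Pi.single_eq_of_ne' h, if_neg h]
    simp [this]
  · intro n hn
    obtain ⟨n, rfl⟩ := Nat.exists_eq_add_of_le' hn
    simp [coeff_C_succ]

theorem coeff_mul_X_eq (s : S) (k : ℕ) :
    P.coeff (s * P.X) k = ∑ n ∈ Finset.range k, if n + 1 = k then P.coeff s n else 0 := by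
  have key : ∀ n, ∑ i ∈ Finset.range (k + 1), P.coeff (P.C (P.coeff s n) * P.X ^ n *
      (P.C (P.coeff P.X i) * P.X ^ i)) k = if n + 1 = k then P.coeff s n else 0 := by
    intro n
    have : ∀ i, P.coeff (P.C (P.coeff s n) * P.X ^ n * (P.C (P.coeff P.X i) * P.X ^ i)) k =
        if i = 1 then (if n + 1 = k then P.coeff s n else 0) else 0 := by
      intro i
      by_cases h : i = 1
      · subst h
        rw [coeff_X, Pi.single_eq_same, map_one, one_mul, mul_assoc, ← pow_add,
          coeff_C_mul_X_pow, Pi.single_apply, if_pos rfl]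
        simp only [eq_comm]
      · rw [coeff_X, Pi.single_eq_of_ne h, if_neg h]
        simp
    simp only [this, Finset.sum_ite_eq', Finset.mem_range]
    split_ifs <;> first | rfl | omega
  rw [(P.coeff_mul s P.X k).eq_sum_range hR k]
  · simp only [key]
  · intro n hn
    rw [key, if_neg (by omega)]

theorem coeff_mul_X_zero (s : S) : P.coeff (s * P.X) 0 = 0 := by
  simp [P.coeff_mul_X_eq hR]

theorem coeff_mul_X_succ (s : S) (k : ℕ) : P.coeff (s * P.X) (k + 1) = P.coeff s k := by
  simp [P.coeff_mul_X_eq hR]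

theorem coeff_mul_X_pow (s : S) (i k : ℕ) :
    P.coeff (s * P.X ^ i) k = if i ≤ k then P.coeff s (k - i) else 0 := by
  induction i generalizing k with
  | zero => simp
  | succ i ih =>
    rw [pow_succ, ← mul_assoc]
    cases k with
    | zero => simp [P.coeff_mul_X_zero hR]
    | succ k => simp [P.coeff_mul_X_succ hR, ih]

theorem coeff_X_mul_eq (s : S) (k : ℕ) :
    P.coeff (P.X * s) k =
      (∑ i ∈ Finset.range (k + 1), if i + 1 = k then P.σ (P.coeff s i) else 0) +
        P.δ (P.coeff s k) := by
  rw [(P.coeff_mul P.X s k).eq_sum_range hR 2]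
  · have h0 : P.coeff P.X 0 = 0 := by rw [coeff_X]; simp
    have h1 : P.coeff P.X 1 = 1 := by rw [coeff_X]; simp
    rw [Finset.sum_range_succ, Finset.sum_range_one, h0, h1]
    simp only [map_zero, zero_mul, Pi.zero_apply, Finset.sum_const_zero, zero_add, map_one,
      one_mul, pow_one]
    have : ∀ i, P.coeff (P.X * (P.C (P.coeff s i) * P.X ^ i)) k =
        (if i + 1 = k then P.σ (P.coeff s i) else 0) +
          (if i = k then P.δ (P.coeff s i) else 0) := by
      intro i
      rw [← mul_assoc, P.X_mul_C, add_mul, mul_assoc, ← pow_succ', coeff_add,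
        coeff_C_mul_X_pow, coeff_C_mul_X_pow, Pi.single_apply, Pi.single_apply]
      simp only [eq_comm]
    simp only [this, Finset.sum_add_distrib]
    simp
  · intro n hn
    have : P.coeff P.X n = 0 := by
      rw [coeff_X, Pi.single_eq_of_ne (by omega)]
    simp [this]

theorem coeff_X_mul_zero (s : S) : P.coeff (P.X * s) 0 = P.δ (P.coeff s 0) := by
  simp [P.coeff_X_mul_eq hR]

theorem coeff_X_mul_succ (s : S) (k : ℕ) :
    P.coeff (P.X * s) (k + 1) = P.σ (P.coeff s k) + P.δ (P.coeff s (k + 1)) := by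
  rw [P.coeff_X_mul_eq hR]
  simp

/-- Each factor `X` moved past a constant either raises the degree (through `σ`) or the `m`-adic
order (through `δ`); in degree `l` at least `n - l` of them did the latter. -/
theorem coeff_X_pow_mul_C_mem {a : R} {j : ℕ} (ha : a ∈ m ^ j) (n l : ℕ) :
    P.coeff (P.X ^ n * P.C a) l ∈ m ^ (j + (n - l)) := by
  induction n generalizing l with
  | zero =>
    cases l with
    | zero => simpa [coeff_C_zero] using ha
    | succ l => simp [coeff_C_succ]
  | succ n ih =>
    rw [pow_succ', mul_assoc]
    cases l with
    | zero =>
      rw [P.coeff_X_mul_zero hR]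
      exact P.δ_mem_pow (ih 0)
    | succ l =>
      rw [P.coeff_X_mul_succ hR]
      refine add_mem ?_ ?_
      · exact Ideal.pow_le_pow_right (by omega) (P.σ_mem_pow (ih l))
      · exact Ideal.pow_le_pow_right (by omega) (P.δ_mem_pow (ih (l + 1)))

/-- A coefficient of a product agrees modulo `m ^ N` with a finite partial sum, so termwise
membership suffices. -/
theorem coeff_mul_mem {s t : S} {k N : ℕ}
    (h : ∀ n i, i ≤ k → P.coeff s n * P.coeff (P.X ^ n * P.C (P.coeff t i)) (k - i) ∈ m ^ N) :
    P.coeff (s * t) k ∈ m ^ N := by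
  obtain ⟨n₀, hn₀⟩ := P.coeff_mul s t k N
  have h1 := hn₀ n₀ le_rfl
  rw [sub_mem_comm_iff] at h1
  refine (Submodule.sub_mem_iff_left _ ?_).1 h1
  refine Submodule.sum_mem _ fun n _ => Submodule.sum_mem _ fun i hi => ?_
  have hik : i ≤ k := by simpa [Nat.lt_succ_iff] using hi
  rw [mul_assoc, ← mul_assoc (P.X ^ n), ← mul_assoc, P.coeff_mul_X_pow hR, if_pos hik,
    P.coeff_C_mul hR]
  exact h n i hik

/-- If the coefficients of `s` lie in `m ^ a` and those of `t` in `m ^ b`, then the coefficients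
of `s * t` lie in `m ^ (a + b)`. -/
theorem coeff_mul_mem_pow_add {s t : S} {a b k : ℕ} (hs : ∀ n, P.coeff s n ∈ m ^ a)
    (ht : ∀ i ≤ k, P.coeff t i ∈ m ^ b) : P.coeff (s * t) k ∈ m ^ (a + b) :=
  P.coeff_mul_mem hR fun n i hi => Ideal.mul_mem_pow_add (hs n)
    (Ideal.pow_le_pow_right (Nat.le_add_right _ _) (P.coeff_X_pow_mul_C_mem hR (ht i hi) _ _))

/-- The filtration of the skew power series ring for which `m` and the variable have degree one
is multiplicative. -/
theorem coeff_mul_mem_pow_sub {s t : S} {a b k : ℕ} (hs : ∀ n, P.coeff s n ∈ m ^ (a - n))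
    (ht : ∀ i, P.coeff t i ∈ m ^ (b - i)) : P.coeff (s * t) k ∈ m ^ (a + b - k) :=
  P.coeff_mul_mem hR fun n i hi => Ideal.pow_le_pow_right (by omega)
    (Ideal.mul_mem_pow_add (hs n) (P.coeff_X_pow_mul_C_mem hR (ht i) n (k - i)))

/-- A left inverse of `1 + y * X` is the fixed point of `z ↦ 1 - z * y * X`. This map contracts for
the filtration that requires the degree `k` coefficient to lie in `m ^ (t - k)`, because right
multiplication by `X` raises degrees by one. -/
theorem X_mem_jacobson : P.X ∈ Ring.jacobson S := by
  rw [← Ideal.jacobson_bot, Ideal.mem_jacobson_iff]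
  intro y
  let Φ : (ℕ → R) →+ (ℕ → R) :=
    { toFun := fun w => P.coeff (-(P.coeff.symm w * y * P.X))
      map_zero' := by simp
      map_add' := fun v w => by
        rw [map_add, add_mul, add_mul, neg_add, map_add] }
  obtain ⟨w, -, hw⟩ := hR.exists_eq_add_of_contracting (fun t k => t - k)
    (fun k a b hab => Nat.sub_le_sub_right hab k) (fun k N => ⟨N + k, by simp⟩) Φ
    (by
      intro t w hw k
      change P.coeff (-(P.coeff.symm w * y * P.X)) k ∈ _
      rw [map_neg, Pi.neg_apply]
      refine neg_mem ?_
      cases k with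
      | zero => rw [P.coeff_mul_X_zero hR]; exact zero_mem _
      | succ k =>
        rw [P.coeff_mul_X_succ hR, Nat.add_sub_add_right]
        exact P.coeff_mul_mem_pow_sub hR (b := 0) (fun n => by simpa using hw n)
          (fun i => by rw [Nat.zero_sub]; exact Ideal.mem_pow_zero _))
    (P.coeff 1) (fun p => by
      rw [Nat.zero_sub]; exact Ideal.mem_pow_zero _)
  refine ⟨P.coeff.symm w, ?_⟩
  rw [Ideal.mem_bot]
  have h : P.coeff.symm w = 1 + -(P.coeff.symm w * y * P.X) := by
    apply P.coeff.injective
    rw [map_add, AddEquiv.apply_symm_apply]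
    exact hw
  nth_rewrite 2 [h]
  abel

end

/-! ### Weierstrass division by `X - A`. -/

section Division

variable {ι : Type*} [Fintype ι]

/-- Right multiplication of row vectors by the matrix `X - A`. -/
def rowMap (A : ι → ι → S) : (ι → S) →ₗ[S] (ι → S) where
  toFun w := fun q => w q * P.X - ∑ p, w p * A p q
  map_add' v w := by
    funext q
    simp only [Pi.add_apply, add_mul, Finset.sum_add_distrib]
    abel
  map_smul' s w := by
    funext q
    simp only [Pi.smul_apply, smul_eq_mul, RingHom.id_apply, mul_sub, Finset.mul_sum, mul_assoc]

/-- Left multiplication of column vectors by the matrix `X - A`. -/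
def colMap (A : ι → ι → S) : (ι → S) →+ (ι → S) where
  toFun d := fun p => P.X * d p - ∑ q, A p q * d q
  map_zero' := by funext p; simp
  map_add' v w := by
    funext q
    simp only [Pi.add_apply, mul_add, Finset.sum_add_distrib]
    abel

theorem rowMap_apply (A : ι → ι → S) (w : ι → S) (q : ι) :
    P.rowMap A w q = w q * P.X - ∑ p, w p * A p q := rfl

theorem colMap_apply (A : ι → ι → S) (d : ι → S) (p : ι) :
    P.colMap A d p = P.X * d p - ∑ q, A p q * d q := rfl

/-- A square matrix over `S` is nilpotent modulo `m`, strictly increasing for a weight function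
`h` with values below `n`. -/
structure IsWeighted (A : ι → ι → S) (h : ι → ℕ) (n : ℕ) : Prop where
  lt : ∀ p, h p < n
  mem : ∀ p q, h p < h q ∨ ∀ k, P.coeff (A p q) k ∈ m

variable (hR : IsCompleteLocal m) {A : ι → ι → S} {h : ι → ℕ} {n : ℕ}

/-- The series with coefficients `w (p, 0), w (p, 1), …`. -/
def ofCoeff (w : ι × ℕ → R) : ι → S := fun p => P.coeff.symm fun k => w (p, k)

theorem coeff_ofCoeff (w : ι × ℕ → R) (p : ι) (k : ℕ) :
    P.coeff (P.ofCoeff w p) k = w (p, k) := by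
  simp [ofCoeff]

theorem ofCoeff_add (v w : ι × ℕ → R) : P.ofCoeff (v + w) = P.ofCoeff v + P.ofCoeff w := by
  funext p
  refine P.ext_coeff fun k => ?_
  simp [ofCoeff]

/-- The map whose fixed points solve the division by `X - A` for row vectors. -/
def rowShift (A : ι → ι → S) : (ι × ℕ → R) →+ (ι × ℕ → R) :=
  AddMonoidHom.mk' (fun w x => P.coeff (∑ p, P.ofCoeff w p * A p x.1) (x.2 + 1)) fun v w => by
    funext x
    simp only [ofCoeff_add, Pi.add_apply, add_mul, Finset.sum_add_distrib, coeff_add]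

/-- The map whose fixed points solve the division by `X - A` for column vectors. -/
def colShift (A : ι → ι → S) : (ι × ℕ → R) →+ (ι × ℕ → R) :=
  AddMonoidHom.mk' (fun d x => P.σ.symm
    (P.coeff (∑ q, A x.1 q * P.ofCoeff d q) (x.2 + 1) - P.δ (d (x.1, x.2 + 1)))) fun v w => by
    funext x
    simp only [ofCoeff_add, Pi.add_apply, mul_add, Finset.sum_add_distrib, coeff_add, map_add,
      map_sub]
    abel

theorem _root_.Nat.exists_le_add_div {n : ℕ} (hn : 0 < n) (c N : ℕ) : ∃ t, N ≤ (t + c) / n :=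
  ⟨N * n, (Nat.le_div_iff_mul_le hn).2 (Nat.le_add_right _ _)⟩

include hR

/-- Count in units of `1 / n` of an exponent. An entry of `A` that raises the weight gains at least
one unit, and an entry in `m` gains `n` units while the weight drops by at most `n - 1`; each step
therefore nets at least one. The bound `c` is preserved throughout. -/
theorem rowShift_contracting (hA : P.IsWeighted A h n) (c t : ℕ) (w : ι × ℕ → R)
    (hw : ∀ x, w x ∈ m ^ max c ((t + (n - 1 - h x.1)) / n)) (x : ι × ℕ) :
    P.rowShift A w x ∈ m ^ max c ((t + 1 + (n - 1 - h x.1)) / n) := by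
  obtain ⟨q, k⟩ := x
  change P.coeff (∑ p, P.ofCoeff w p * A p q) (k + 1) ∈ _
  rw [coeff_sum]
  refine Submodule.sum_mem _ fun p _ => ?_
  have hw' : ∀ i, P.coeff (P.ofCoeff w p) i ∈ m ^ max c ((t + (n - 1 - h p)) / n) :=
    fun i => by rw [coeff_ofCoeff]; exact hw (p, i)
  have hp := hA.lt p
  have hq := hA.lt q
  rcases hA.mem p q with hlt | hmem
  · refine Ideal.pow_le_pow_right ?_ (P.coeff_mul_mem_pow_add hR (b := 0) hw'
      (fun i _ => Ideal.mem_pow_zero _))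
    exact max_le_max le_rfl (Nat.div_le_div_right (by dsimp only; omega))
  · refine Ideal.pow_le_pow_right ?_ (P.coeff_mul_mem_pow_add hR (b := 1) hw'
      (fun i _ => by rw [Submodule.pow_one]; exact hmem i))
    have h1 : (t + 1 + (n - 1 - h q)) / n ≤ (t + (n - 1 - h p)) / n + 1 := by
      rw [← Nat.add_div_right _ (by omega)]
      exact Nat.div_le_div_right (by omega)
    dsimp only
    omega

/-- As for rows, with the sign of the weight reversed because `A` now acts on the other side. The
term with `δ` gains a whole exponent, and `σ⁻¹` preserves powers of `m`. -/
theorem colShift_contracting (hA : P.IsWeighted A h n) (t : ℕ) (w : ι × ℕ → R)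
    (hw : ∀ x, w x ∈ m ^ ((t + h x.1) / n)) (x : ι × ℕ) :
    P.colShift A w x ∈ m ^ ((t + 1 + h x.1) / n) := by
  obtain ⟨q, k⟩ := x
  change P.σ.symm (P.coeff (∑ p, A q p * P.ofCoeff w p) (k + 1) - P.δ (w (q, k + 1))) ∈ _
  refine P.σ_symm_mem_pow hR (sub_mem ?_ ?_)
  · rw [coeff_sum]
    refine Submodule.sum_mem _ fun p _ => ?_
    have hw' : ∀ i, P.coeff (P.ofCoeff w p) i ∈ m ^ ((t + h p) / n) :=
      fun i => by rw [coeff_ofCoeff]; exact hw (p, i)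
    have hp := hA.lt p
    have hq := hA.lt q
    rcases hA.mem q p with hlt | hmem
    · refine Ideal.pow_le_pow_right ?_ (P.coeff_mul_mem_pow_add hR (a := 0)
        (fun i => Ideal.mem_pow_zero _) (fun i _ => hw' i))
      rw [zero_add]
      exact Nat.div_le_div_right (by dsimp only; omega)
    · refine Ideal.pow_le_pow_right ?_ (P.coeff_mul_mem_pow_add hR (a := 1)
        (fun i => by rw [Submodule.pow_one]; exact hmem i) (fun i _ => hw' i))
      rw [add_comm 1, ← Nat.add_div_right _ (by omega)]
      exact Nat.div_le_div_right (by dsimp only; omega)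
  · refine Ideal.pow_le_pow_right ?_ (P.δ_mem_pow (hw (q, k + 1)))
    have hq := hA.lt q
    rw [← Nat.add_div_right _ (by omega)]
    exact Nat.div_le_div_right (by dsimp only; omega)

/-- Weierstrass division of row vectors by `X - A`: existence. -/
theorem exists_eq_rowMap_add (hA : P.IsWeighted A h n) (c : ℕ) (v : ι → S)
    (hv : ∀ p k, P.coeff (v p) k ∈ m ^ c) :
    ∃ (w : ι → S) (u : ι → R), (∀ p, u p ∈ m ^ c) ∧
      v = P.rowMap A w + fun p => P.C (u p) := by
  -- Comparing coefficients of degree `k + 1` in `v = w (X - A) + u` gives `w_k = v_(k+1) + (w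
  -- A)_(k+1)`. The maximum with `c` keeps `w`, and hence the remainder, in `m ^ c`.
  obtain ⟨w, hw0, hw⟩ := hR.exists_eq_add_of_contracting
    (fun t (x : ι × ℕ) => max c ((t + (n - 1 - h x.1)) / n))
    (fun x a b hab => max_le_max le_rfl (Nat.div_le_div_right (by omega)))
    (fun x N => by
      obtain ⟨t, ht⟩ := Nat.exists_le_add_div (Nat.zero_lt_of_lt (hA.lt x.1)) (n - 1 - h x.1) N
      exact ⟨t, le_max_of_le_right ht⟩)
    (P.rowShift A) (P.rowShift_contracting hR hA c) (fun x => P.coeff (v x.1) (x.2 + 1))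
    (fun x => by
      have hx := hA.lt x.1
      rw [Nat.div_eq_of_lt (by omega), max_eq_left (Nat.zero_le c)]
      exact hv x.1 (x.2 + 1))
  have hw0' : ∀ p k, P.coeff (P.ofCoeff w p) k ∈ m ^ c := fun p k => by
    rw [coeff_ofCoeff]
    exact Ideal.pow_le_pow_right (le_max_left _ _) (hw0 (p, k))
  refine ⟨P.ofCoeff w, fun p => P.coeff (v p + ∑ q, P.ofCoeff w q * A q p) 0, fun p => ?_, ?_⟩
  · beta_reduce
    rw [coeff_add, coeff_sum]
    refine add_mem (hv p 0) (Submodule.sum_mem _ fun q _ => ?_)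
    exact P.coeff_mul_mem_pow_add hR (b := 0) (hw0' q) (fun i _ => Ideal.mem_pow_zero _)
  · funext p
    refine P.ext_coeff fun k => ?_
    rw [Pi.add_apply, rowMap_apply, coeff_add, coeff_sub]
    cases k with
    | zero => beta_reduce; rw [P.coeff_mul_X_zero hR, coeff_C_zero, coeff_add]; abel
    | succ k =>
      rw [P.coeff_mul_X_succ hR, coeff_C_succ, coeff_ofCoeff]
      have : w (p, k) = P.coeff (v p) (k + 1) +
        P.coeff (∑ q, P.ofCoeff w q * A q p) (k + 1) := congrFun hw (p, k)
      rw [this]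
      abel

/-- Weierstrass division of row vectors by `X - A`: uniqueness. -/
theorem eq_zero_of_rowMap_eq (hA : P.IsWeighted A h n) (w : ι → S) (u : ι → R)
    (hw : P.rowMap A w = fun p => P.C (u p)) : w = 0 ∧ u = 0 := by
  let w' : ι × ℕ → R := fun x => P.coeff (w x.1) x.2
  have hw' : P.ofCoeff w' = w := by
    funext p
    exact P.ext_coeff fun k => P.coeff_ofCoeff w' p k
  have h0 : w' = 0 := by
    refine hR.eq_zero_of_contracting (fun t (x : ι × ℕ) => max 0 ((t + (n - 1 - h x.1)) / n))
      (fun x N => ?_) (fun x => ?_) (P.rowShift A) (P.rowShift_contracting hR hA 0) w' ?_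
    · obtain ⟨t, ht⟩ := Nat.exists_le_add_div (Nat.zero_lt_of_lt (hA.lt x.1)) (n - 1 - h x.1) N
      exact ⟨t, le_max_of_le_right ht⟩
    · have hx := hA.lt x.1
      rw [Nat.div_eq_of_lt (by omega), max_eq_left le_rfl]
    · funext ⟨p, k⟩
      have := congrArg (fun s => P.coeff s (k + 1)) (congrFun hw p)
      beta_reduce at this
      rw [rowMap_apply, coeff_sub, P.coeff_mul_X_succ hR, coeff_C_succ, sub_eq_zero] at this
      change P.coeff (∑ q, P.ofCoeff w' q * A q p) (k + 1) = P.coeff (w p) k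
      rw [hw', this]
  have hw0 : w = 0 := by
    rw [← hw', h0]
    funext p
    exact P.ext_coeff fun k => by rw [coeff_ofCoeff]; simp
  refine ⟨hw0, funext fun p => P.C_injective ?_⟩
  rw [← congrFun hw p, hw0]
  simp

/-- Weierstrass division of column vectors by `X - A`: existence. -/
theorem exists_eq_colMap_add (hA : P.IsWeighted A h n) (v : ι → S) :
    ∃ (d : ι → S) (u : ι → R), v = P.colMap A d + fun p => P.C (u p) := by
  -- In degree `k + 1` the product `X d` has coefficient `σ(d_k) + δ(d_(k+1))`; solving for `d_k`
  -- requires `σ⁻¹`.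
  obtain ⟨w, -, hw⟩ := hR.exists_eq_add_of_contracting
    (fun t (x : ι × ℕ) => (t + h x.1) / n)
    (fun x a b hab => Nat.div_le_div_right (by omega))
    (fun x N => Nat.exists_le_add_div (Nat.zero_lt_of_lt (hA.lt x.1)) _ N)
    (P.colShift A) (P.colShift_contracting hR hA)
    (fun x => P.σ.symm (P.coeff (v x.1) (x.2 + 1)))
    (fun x => by
      have hx := hA.lt x.1
      rw [Nat.div_eq_of_lt (by omega)]
      exact Ideal.mem_pow_zero _)
  refine ⟨P.ofCoeff w, fun p => P.coeff (v p - P.colMap A (P.ofCoeff w) p) 0, ?_⟩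
  funext p
  refine P.ext_coeff fun k => ?_
  rw [Pi.add_apply, coeff_add]
  cases k with
  | zero => beta_reduce; rw [coeff_C_zero, coeff_sub]; abel
  | succ k =>
    rw [coeff_C_succ, colMap_apply, coeff_sub, P.coeff_X_mul_succ hR, coeff_ofCoeff,
      coeff_ofCoeff]
    have : w (p, k) = P.σ.symm (P.coeff (v p) (k + 1)) + P.σ.symm
      (P.coeff (∑ q, A p q * P.ofCoeff w q) (k + 1) - P.δ (w (p, k + 1))) := congrFun hw (p, k)
    rw [this, map_add, RingEquiv.apply_symm_apply, RingEquiv.apply_symm_apply]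
    abel

/-- Weierstrass division of column vectors by `X - A`: uniqueness. -/
theorem eq_zero_of_colMap_eq (hA : P.IsWeighted A h n) (d : ι → S) (u : ι → R)
    (hd : P.colMap A d = fun p => P.C (u p)) : d = 0 ∧ u = 0 := by
  let w' : ι × ℕ → R := fun x => P.coeff (d x.1) x.2
  have hw' : P.ofCoeff w' = d := by
    funext p
    exact P.ext_coeff fun k => P.coeff_ofCoeff w' p k
  have h0 : w' = 0 := by
    refine hR.eq_zero_of_contracting (fun t (x : ι × ℕ) => (t + h x.1) / n)
      (fun x N => Nat.exists_le_add_div (Nat.zero_lt_of_lt (hA.lt x.1)) _ N) (fun x => ?_)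
      (P.colShift A) (P.colShift_contracting hR hA) w' ?_
    · have hx := hA.lt x.1
      exact Nat.div_eq_of_lt (by omega)
    · funext ⟨p, k⟩
      have := congrArg (fun s => P.coeff s (k + 1)) (congrFun hd p)
      beta_reduce at this
      rw [colMap_apply, coeff_sub, P.coeff_X_mul_succ hR, coeff_C_succ, sub_eq_zero] at this
      change P.σ.symm (P.coeff (∑ q, A p q * P.ofCoeff w' q) (k + 1) -
        P.δ (P.coeff (d p) (k + 1))) = P.coeff (d p) k
      rw [hw', ← this, add_sub_cancel_right, RingEquiv.symm_apply_apply]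
  have hw0 : d = 0 := by
    rw [← hw', h0]
    funext p
    exact P.ext_coeff fun k => by rw [coeff_ofCoeff]; simp
  refine ⟨hw0, funext fun p => P.C_injective ?_⟩
  rw [← congrFun hd p, hw0]
  simp

end Division

end LocalSkewPowerSeriesRing

/-! ### Generators on which the variable acts by a weighted matrix. -/

/-- `V` is a quotient of a finite power of `R ⧸ m`, whose `R`-submodules are its `R ⧸ m`-submodules.
-/
theorem isArtinian_of_finite_of_smul_eq_zero {R : Type u} [Ring R] (m : Ideal R) [m.IsTwoSided]
    [IsArtinianRing (R ⧸ m)] {V : Type v} [AddCommGroup V] [Module R V] [Module.Finite R V]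
    (h : ∀ a ∈ m, ∀ v : V, a • v = 0) : IsArtinian R V := by
  have h1 : IsArtinian R (R ⧸ m) := by
    let l : (R ⧸ m) →ₛₗ[Ideal.Quotient.mk m] (R ⧸ m) :=
      { toFun := id, map_add' := fun _ _ => rfl, map_smul' := fun r x => by
          obtain ⟨x, rfl⟩ := Ideal.Quotient.mk_surjective x
          rfl }
    have : RingHomSurjective (Ideal.Quotient.mk m) := ⟨Ideal.Quotient.mk_surjective⟩
    exact (LinearMap.isArtinian_iff_of_bijective l Function.bijective_id).2 inferInstance
  obtain ⟨k, e, he⟩ := Module.Finite.exists_fin (R := R) (M := V)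
  let f : Fin k → (R ⧸ m) →ₗ[R] V := fun j =>
    Submodule.liftQ m (LinearMap.toSpanSingleton R V (e j)) fun a ha => by
      simpa using h a ha (e j)
  have hf : ∀ j r, f j (Submodule.Quotient.mk r) = r • e j := fun j r => rfl
  let F : (Fin k → R ⧸ m) →ₗ[R] V := ∑ j, (f j).comp (LinearMap.proj j)
  refine isArtinian_of_surjective _ F ?_
  intro v
  have hv : v ∈ Submodule.span R (Set.range e) := he ▸ trivial
  obtain ⟨c, rfl⟩ := (Submodule.mem_span_range_iff_exists_fun R).1 hv
  refine ⟨fun j => Submodule.Quotient.mk (c j), ?_⟩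
  simp only [F, LinearMap.sum_apply, LinearMap.comp_apply, LinearMap.proj_apply, hf]

namespace LocalSkewPowerSeriesRing

variable {R S : Type u} [Ring R] [Ring S] {m : Ideal R} [m.IsTwoSided]
  (P : LocalSkewPowerSeriesRing m S) (hR : IsCompleteLocal m)

/-- The ideal of the series all of whose coefficients lie in `m`. -/
def coeffIdeal : Ideal S where
  carrier := {s | ∀ k, P.coeff s k ∈ m}
  add_mem' hs ht k := by rw [coeff_add]; exact add_mem (hs k) (ht k)
  zero_mem' k := by rw [coeff_zero]; exact zero_mem _
  smul_mem' s t ht k := by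
    refine (Submodule.pow_one m).le ?_
    exact P.coeff_mul_mem_pow_add hR (a := 0) (b := 1) (fun _ => Ideal.mem_pow_zero _)
      (fun i _ => by rw [Submodule.pow_one]; exact ht i)

theorem mul_mem_coeffIdeal {s : S} (hs : s ∈ P.coeffIdeal hR) (t : S) :
    s * t ∈ P.coeffIdeal hR := fun k => by
  refine (Submodule.pow_one m).le ?_
  exact P.coeff_mul_mem_pow_add hR (a := 1) (b := 0)
    (fun i => by rw [Submodule.pow_one]; exact hs i) (fun _ _ => Ideal.mem_pow_zero _)

theorem C_mem_coeffIdeal {a : R} (ha : a ∈ m) : P.C a ∈ P.coeffIdeal hR := fun k => by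
  cases k with
  | zero => rwa [coeff_C_zero]
  | succ k => rw [coeff_C_succ]; exact zero_mem _

section Module

variable {M : Type v} [AddCommGroup M] [Module R M] [Module S M]
  (hC : ∀ (r : R) (x : M), P.C r • x = r • x)

include hC hR

/-- The variable acts nilpotently on a finitely generated `R`-module killed by `m`. -/
theorem exists_X_pow_smul_eq_zero [IsNoetherianRing R] [Module.Finite R M]
    (hm : ∀ a ∈ m, ∀ x : M, a • x = 0) : ∃ n, ∀ x : M, P.X ^ n • x = 0 := by
  let : Module R S := Module.compHom S P.C
  have : IsScalarTower R S M := ⟨fun r s x => by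
    rw [← hC, ← mul_smul]; rfl⟩
  have := hR.artinian
  have : IsArtinian R M := isArtinian_of_finite_of_smul_eq_zero m hm
  have : IsArtinian S M := isArtinian_of_tower R inferInstance
  have : IsNoetherian S M := isNoetherian_of_tower R inferInstance
  -- The `S`-submodules generated by `X ^ n M` decrease, so they stabilise; as `X` is in the
  -- Jacobson radical, Nakayama kills the stable value.
  let N : ℕ → Submodule S M := fun n => Submodule.span S (Set.range fun x : M => P.X ^ n • x)
  have hN : Antitone N := antitone_nat_of_succ_le fun n => by
    refine Submodule.span_le.2 ?_
    rintro _ ⟨x, rfl⟩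
    refine Submodule.subset_span ⟨P.X • x, ?_⟩
    simp only [← mul_smul, pow_succ]
  obtain ⟨n, hn⟩ := IsArtinian.monotone_stabilizes
    ⟨fun n => OrderDual.toDual (N n), fun a b hab => hN hab⟩
  have hstab : N n = N (n + 1) := hn (n + 1) n.le_succ
  have hbot : N n = ⊥ := by
    refine Submodule.FG.eq_bot_of_le_jacobson_smul (IsNoetherian.noetherian _) ?_
    conv_lhs => rw [hstab]
    refine Submodule.span_le.2 ?_
    rintro _ ⟨x, rfl⟩
    change P.X ^ (n + 1) • x ∈ _
    rw [pow_succ', mul_smul]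
    exact Submodule.smul_mem_smul (P.X_mem_jacobson hR) (Submodule.subset_span ⟨x, rfl⟩)
  refine ⟨n, fun x => ?_⟩
  have : P.X ^ n • x ∈ N n := Submodule.subset_span ⟨x, rfl⟩
  rwa [hbot, Submodule.mem_bot] at this

theorem exists_X_pow_smul_mem [IsNoetherianRing R] [Module.Finite R M] :
    ∃ n, ∀ x : M, P.X ^ n • x ∈ P.coeffIdeal hR • (⊤ : Submodule S M) := by
  let W : Submodule S M := P.coeffIdeal hR • (⊤ : Submodule S M)
  let : Module R (M ⧸ W) := Module.compHom (M ⧸ W) P.C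
  let f : M →ₗ[R] M ⧸ W :=
    { toFun := W.mkQ
      map_add' := map_add _
      map_smul' := fun r x => by
        rw [← hC, map_smul]
        rfl }
  have : Module.Finite R (M ⧸ W) := Module.Finite.of_surjective f W.mkQ_surjective
  obtain ⟨n, hn⟩ := P.exists_X_pow_smul_eq_zero hR (M := M ⧸ W) (fun r x => rfl) (by
    intro a ha x
    obtain ⟨x, rfl⟩ := W.mkQ_surjective x
    change P.C a • W.mkQ x = 0
    rw [← map_smul, Submodule.mkQ_apply, Submodule.Quotient.mk_eq_zero]
    exact Submodule.smul_mem_smul (P.C_mem_coeffIdeal hR ha) trivial)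
  refine ⟨n, fun x => ?_⟩
  have := hn (W.mkQ x)
  rwa [← map_smul, Submodule.mkQ_apply, Submodule.Quotient.mk_eq_zero] at this

/-- Constants multiplied on the right are absorbed, because the series with coefficients in `m` form
a two-sided ideal. -/
theorem exists_sum_of_mem_coeffIdeal_smul {ι : Type*} [Fintype ι] (e : ι → M)
    (he : Submodule.span R (Set.range e) = ⊤) {x : M}
    (hx : x ∈ P.coeffIdeal hR • (⊤ : Submodule S M)) :
    ∃ b : ι → S, (∀ j, b j ∈ P.coeffIdeal hR) ∧ x = ∑ j, b j • e j := by
  refine Submodule.smul_induction_on hx ?_ ?_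
  · intro s hs y _
    have hy : y ∈ Submodule.span R (Set.range e) := he ▸ trivial
    obtain ⟨c, rfl⟩ := (Submodule.mem_span_range_iff_exists_fun R).1 hy
    refine ⟨fun j => s * P.C (c j), fun j => P.mul_mem_coeffIdeal hR hs _, ?_⟩
    simp only [Finset.smul_sum, mul_smul, hC]
  · rintro _ _ ⟨b, hb, rfl⟩ ⟨b', hb', rfl⟩
    exact ⟨fun j => b j + b' j, fun j => add_mem (hb j) (hb' j), by
      simp only [add_smul, Finset.sum_add_distrib]⟩

omit hC hR [Module R M] in
theorem sum_rowMap_smul {ι : Type*} [Fintype ι] (e : ι → M) (A : ι → ι → S)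
    (hA : ∀ p, P.X • e p = ∑ q, A p q • e q) (w : ι → S) :
    ∑ q, P.rowMap A w q • e q = 0 := by
  simp only [rowMap_apply, sub_smul, mul_smul, hA, Finset.sum_smul, Finset.sum_sub_distrib,
    Finset.smul_sum]
  rw [Finset.sum_comm, sub_self]

/-- A finitely generated `R`-module with an action of the skew power series ring has generators on
which the variable acts by a weighted matrix over `R`. -/
theorem exists_weighted_generators [IsNoetherianRing R] [Module.Finite R M] :
    ∃ (ι : Type) (_ : Fintype ι) (_ : DecidableEq ι) (e : ι → M) (A : ι → ι → R) (h : ι → ℕ)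
      (n : ℕ), P.IsWeighted (fun p q => P.C (A p q)) h n ∧
        Submodule.span R (Set.range e) = ⊤ ∧ ∀ p, P.X • e p = ∑ q, A p q • e q := by
  obtain ⟨k, g, hg⟩ := Module.Finite.exists_fin (R := R) (M := M)
  obtain ⟨n, hn⟩ := P.exists_X_pow_smul_mem hR hC
  -- The exponent is made positive so that the block `1, X, …, X ^ n` of powers is nonempty even
  -- when `n = 0`.
  have hn' : ∀ x : M, P.X ^ (n + 1) • x ∈ P.coeffIdeal hR • (⊤ : Submodule S M) := fun x => by
    rw [pow_succ, mul_smul]; exact hn _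
  choose B hB hBg using fun j => P.exists_sum_of_mem_coeffIdeal_smul hR hC g hg (hn' (g j))
  let e : Fin (n + 1) × Fin k → M := fun p => P.X ^ (p.1 : ℕ) • g p.2
  let last : Fin k → Fin (n + 1) × Fin k → S := fun j q => if q.1 = 0 then B j q.2 else 0
  have hlast : ∀ j, ∑ q, last j q • e q = P.X ^ (n + 1) • g j := by
    intro j
    rw [hBg, Fintype.sum_prod_type, Finset.sum_comm]
    refine Finset.sum_congr rfl fun l _ => ?_
    simp [last, e, ite_smul]
  -- A block companion matrix: `X` shifts `X ^ i g_j` to `X ^ (i + 1) g_j`, raising the weight `i`,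
  -- and the top power returns with coefficients in `m`. Its last rows are still power series.
  let A₀ : Fin (n + 1) × Fin k → Fin (n + 1) × Fin k → S := fun p q =>
    if hp : (p.1 : ℕ) + 1 < n + 1 then (if q = (⟨p.1 + 1, hp⟩, p.2) then 1 else 0)
    else last p.2 q
  have hlast_mem : ∀ j q i, P.coeff (last j q) i ∈ m := by
    intro j q i
    by_cases hq : q.1 = 0
    · simp only [last, if_pos hq]; exact hB j q.2 i
    · simp only [last, if_neg hq, coeff_zero]; exact zero_mem _
  have hX : ∀ p : Fin (n + 1) × Fin k, ¬ (p.1 : ℕ) + 1 < n + 1 →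
      P.X • e p = P.X ^ (n + 1) • g p.2 := by
    intro p hp
    have : (p.1 : ℕ) = n := by have := p.1.2; omega
    simp only [e, this, ← mul_smul, pow_succ']
  have hX' : ∀ (p : Fin (n + 1) × Fin k) (hp : (p.1 : ℕ) + 1 < n + 1),
      P.X • e p = e (⟨p.1 + 1, hp⟩, p.2) := by
    intro p hp
    simp only [e, ← mul_smul, pow_succ']
  have hA₀ : P.IsWeighted A₀ (fun p => p.1) (n + 1) := by
    refine ⟨fun p => p.1.2, fun p q => ?_⟩
    by_cases hp : (p.1 : ℕ) + 1 < n + 1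
    · by_cases hq : q = (⟨p.1 + 1, hp⟩, p.2)
      · left; simp [hq]
      · right; intro i; simp only [A₀, dif_pos hp, if_neg hq, coeff_zero]; exact zero_mem _
    · right; intro i; simp only [A₀, dif_neg hp]; exact hlast_mem _ _ _
  have hA₀e : ∀ p, P.X • e p = ∑ q, A₀ p q • e q := by
    intro p
    by_cases hp : (p.1 : ℕ) + 1 < n + 1
    · simp only [A₀, dif_pos hp, ite_smul, one_smul, zero_smul, Finset.sum_ite_eq',
        Finset.mem_univ, if_true, hX' p hp]
    · simp only [A₀, dif_neg hp, hlast, hX p hp]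
  have hdiv : ∀ j, ∃ u : Fin (n + 1) × Fin k → R, (∀ p, u p ∈ m) ∧
      P.X ^ (n + 1) • g j = ∑ q, u q • e q := by
    intro j
    -- Multiples of `X - A₀` annihilate the generators, so a last row may be replaced by its
    -- remainder, which is constant; `c = 1` keeps its entries in `m`.
    obtain ⟨w, u, hu, hw⟩ := P.exists_eq_rowMap_add hR hA₀ 1 (last j)
      (fun q i => by rw [Submodule.pow_one]; exact hlast_mem j q i)
    refine ⟨u, fun p => by simpa [Submodule.pow_one] using hu p, ?_⟩
    rw [← hlast, hw]
    simp only [Pi.add_apply, add_smul, Finset.sum_add_distrib, P.sum_rowMap_smul e A₀ hA₀e,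
      zero_add, hC]
  choose U hU hUe using hdiv
  refine ⟨Fin (n + 1) × Fin k, inferInstance, inferInstance, e, fun p q =>
    if hp : (p.1 : ℕ) + 1 < n + 1 then (if q = (⟨p.1 + 1, hp⟩, p.2) then 1 else 0)
    else U p.2 q, fun p => p.1, n + 1, ⟨fun p => p.1.2, fun p q => ?_⟩, ?_, fun p => ?_⟩
  · by_cases hp : (p.1 : ℕ) + 1 < n + 1
    · by_cases hq : q = (⟨p.1 + 1, hp⟩, p.2)
      · left; simp [hq]
      · right; intro i; simp only [dif_pos hp, if_neg hq, map_zero, coeff_zero]; exact zero_mem _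
    · right; intro i; simp only [dif_neg hp]; exact P.C_mem_coeffIdeal hR (hU _ _) i
  · rw [eq_top_iff, ← hg, Submodule.span_le]
    rintro _ ⟨j, rfl⟩
    exact Submodule.subset_span ⟨(0, j), by simp [e]⟩
  · by_cases hp : (p.1 : ℕ) + 1 < n + 1
    · simp only [dif_pos hp, ite_smul, one_smul, zero_smul, Finset.sum_ite_eq',
        Finset.mem_univ, if_true, hX' p hp]
    · simp only [dif_neg hp, ← hUe, hX p hp]

end Module

end LocalSkewPowerSeriesRing

/-! ### The module of a weighted matrix and its free resolution. -/

open CategoryTheory Abelian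

namespace LocalSkewPowerSeriesRing

variable {R S : Type u} [Ring R] [Ring S] {m : Ideal R} [m.IsTwoSided]
  (P : LocalSkewPowerSeriesRing m S)

/-- A weighted matrix over `R`, the matrix of the action of the variable on a module over the skew
power series ring that is free of finite rank over `R`. -/
structure Frame where
  /-- the index set of the basis -/
  ι : Type
  [fintype : Fintype ι]
  [decEq : DecidableEq ι]
  /-- the matrix of the variable -/
  A : ι → ι → R
  /-- the weight function -/
  h : ι → ℕ
  /-- the bound for the weights -/
  n : ℕ
  isWeighted : P.IsWeighted (fun p q => P.C (A p q)) h n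

attribute [instance] Frame.fintype Frame.decEq

/-- The restriction of scalars along the inclusion of the constants. -/
noncomputable abbrev res : ModuleCat.{u} S ⥤ ModuleCat.{u} R := ModuleCat.restrictScalars P.C

namespace Frame

variable {P} (F : P.Frame)

/-- The matrix of the variable, with entries in the skew power series ring. -/
def mat (p q : F.ι) : S := P.C (F.A p q)

/-- The module of row vectors. -/
abbrev rows : ModuleCat.{u} S := ModuleCat.of S (F.ι → S)

/-- The module over the skew power series ring defined by a weighted matrix. -/
abbrev module : ModuleCat.{u} S :=
  ModuleCat.of S ((F.ι → S) ⧸ LinearMap.range (P.rowMap F.mat))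

/-- The projection of row vectors to the module. -/
def proj : (F.ι → S) →ₗ[S] F.module := Submodule.mkQ (LinearMap.range (P.rowMap F.mat))

/-- The differential of the free resolution of the module. -/
def diff : F.rows ⟶ F.rows := ModuleCat.ofHom (P.rowMap F.mat)

/-- The augmentation of the free resolution of the module. -/
def aug : F.rows ⟶ F.module := ModuleCat.ofHom F.proj

theorem diff_aug : F.diff ≫ F.aug = 0 :=
  ModuleCat.hom_ext (LinearMap.range_mkQ_comp (P.rowMap F.mat))

/-- The short complex `S ^ ι ⟶ S ^ ι ⟶ S ^ ι ⧸ (X - A)`. -/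
abbrev complex : ShortComplex (ModuleCat.{u} S) := ShortComplex.mk F.diff F.aug F.diff_aug

theorem proj_surjective : Function.Surjective F.proj := Submodule.mkQ_surjective _

theorem proj_eq_zero_iff (v : F.ι → S) : F.proj v = 0 ↔ ∃ w, P.rowMap F.mat w = v :=
  (Submodule.Quotient.mk_eq_zero _).trans LinearMap.mem_range

/-- The basis of the module. -/
def basisVec (p : F.ι) : F.module := F.proj (Pi.single p 1)

theorem proj_eq_sum (v : F.ι → S) : F.proj v = ∑ p, v p • F.basisVec p := by
  simp only [basisVec, ← map_smul, ← map_sum]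
  congr 1
  funext q
  simp [Finset.sum_apply, Pi.single_apply]

/-- A linear map out of the module, given by the images of the basis. -/
def desc (M : ModuleCat.{u} S) (e : F.ι → M) (he : ∀ p, P.X • e p = ∑ q, F.mat p q • e q) :
    F.module ⟶ M :=
  ModuleCat.ofHom (Submodule.liftQ _ (Fintype.linearCombination S e) (by
    rintro _ ⟨w, rfl⟩
    rw [LinearMap.mem_ker, Fintype.linearCombination_apply]
    exact P.sum_rowMap_smul (M := M) e F.mat he w))

theorem desc_proj (M : ModuleCat.{u} S) (e : F.ι → M)
    (he : ∀ p, P.X • e p = ∑ q, F.mat p q • e q) (v : F.ι → S) :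
    (F.desc M e he).hom (F.proj v) = ∑ p, v p • e p := rfl

variable (hR : IsCompleteLocal m)

include hR

theorem shortExact : F.complex.ShortExact :=
  ModuleCat.shortComplex_shortExact _
    (fun v => F.proj_eq_zero_iff v)
    ((injective_iff_map_eq_zero (P.rowMap F.mat)).2 fun w hw =>
      (P.eq_zero_of_rowMap_eq hR F.isWeighted w 0 (by
        refine (show P.rowMap F.mat w = 0 from hw).trans ?_
        funext p
        simp)).1)
    F.proj_surjective

theorem exists_eq_sum (x : F.module) : ∃ u : F.ι → R, x = ∑ p, P.C (u p) • F.basisVec p := by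
  obtain ⟨v, rfl⟩ := F.proj_surjective x
  obtain ⟨w, u, -, rfl⟩ := P.exists_eq_rowMap_add hR F.isWeighted 0 v
    (fun _ _ => Ideal.mem_pow_zero _)
  refine ⟨u, ?_⟩
  have hw : F.proj (P.rowMap (fun p q => P.C (F.A p q)) w) = 0 :=
    (F.proj_eq_zero_iff _).2 ⟨w, rfl⟩
  rw [map_add, hw, zero_add, proj_eq_sum]

theorem eq_zero_of_proj_C_eq_zero (u : F.ι → R) (hu : F.proj (fun p => P.C (u p)) = 0) :
    u = 0 := by
  obtain ⟨w, hw⟩ := (F.proj_eq_zero_iff _).1 hu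
  exact (P.eq_zero_of_rowMap_eq hR F.isWeighted w u hw).2

/-- Existence of row division says that the basis vectors span over `R`, uniqueness that they are
independent. -/
theorem exists_linearEquiv : ∃ l : (F.ι → R) ≃ₗ[R] P.res.obj F.module,
    ∀ u, l u = F.proj (fun p => P.C (u p)) := by
  let l : (F.ι → R) →ₗ[R] P.res.obj F.module :=
    { toFun := fun u => F.proj (fun p => P.C (u p))
      map_add' := fun u v => by
        simp only [Pi.add_apply, map_add]
        exact map_add F.proj (fun p => P.C (u p)) (fun p => P.C (v p))
      map_smul' := fun r u => by
        simp only [Pi.smul_apply, smul_eq_mul, map_mul]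
        exact map_smul F.proj (P.C r) (fun p => P.C (u p)) }
  refine ⟨LinearEquiv.ofBijective l ⟨?_, ?_⟩, fun u => rfl⟩
  · rw [← LinearMap.ker_eq_bot, LinearMap.ker_eq_bot']
    exact fun u hu => F.eq_zero_of_proj_C_eq_zero hR u hu
  · intro x
    obtain ⟨u, hu⟩ := F.exists_eq_sum hR x
    exact ⟨u, by rw [hu, ← proj_eq_sum]; rfl⟩

theorem projective : Projective (P.res.obj F.module) := by
  obtain ⟨l, -⟩ := F.exists_linearEquiv hR
  have : Module.Projective R (P.res.obj F.module) := Module.Projective.of_equiv l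
  exact (IsProjective.iff_projective (R := R) (P.res.obj F.module)).1 this

theorem finite : Module.Finite R (P.res.obj F.module) := by
  obtain ⟨l, -⟩ := F.exists_linearEquiv hR
  exact Module.Finite.equiv l

end Frame

end LocalSkewPowerSeriesRing

/-! ### `Ext` of the module of a weighted matrix, and naturality. -/

namespace LocalSkewPowerSeriesRing.Frame

variable {R S : Type u} [Ring R] [Ring S] {m : Ideal R} [m.IsTwoSided]
  {P : LocalSkewPowerSeriesRing m S} (F : P.Frame) (hR : IsCompleteLocal m)

/-- The map from row vectors to the ring given by a column vector. -/
def col (d : F.ι → S) : F.rows ⟶ ModuleCat.of S S :=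
  ModuleCat.ofHom (Fintype.linearCombination S d)

theorem col_apply (d w : F.ι → S) : (F.col d).hom w = ∑ p, w p * d p := rfl

theorem col_add (d d' : F.ι → S) : F.col (d + d') = F.col d + F.col d' := by
  refine ModuleCat.hom_ext (LinearMap.ext fun (w : F.ι → S) => ?_)
  change ∑ p, w p * (d p + d' p) = ∑ p, w p * d p + ∑ p, w p * d' p
  simp only [mul_add, Finset.sum_add_distrib]

theorem col_injective : Function.Injective F.col := by
  intro d d' h
  funext p
  have := LinearMap.congr_fun (congrArg ModuleCat.Hom.hom h) (Pi.single p 1)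
  rw [col_apply, col_apply] at this
  simpa [Pi.single_apply] using this

theorem col_surjective : Function.Surjective F.col := by
  intro f
  refine ⟨fun p => f.hom (Pi.single p 1), ?_⟩
  refine ModuleCat.hom_ext (LinearMap.pi_ext' fun p => LinearMap.ext_ring ?_)
  change ∑ q, (Pi.single p 1 : F.ι → S) q * _ = f.hom (Pi.single p 1)
  simp [Pi.single_apply]

theorem diff_comp_col (d : F.ι → S) : F.diff ≫ F.col d = F.col (P.colMap F.mat d) := by
  refine ModuleCat.hom_ext (LinearMap.ext fun (w : F.ι → S) => ?_)
  change ∑ q, P.rowMap F.mat w q * d q = ∑ p, w p * P.colMap F.mat d p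
  simp only [rowMap_apply, colMap_apply, sub_mul, mul_sub, Finset.sum_sub_distrib, mul_assoc,
    Finset.sum_mul, Finset.mul_sum]
  rw [Finset.sum_comm (f := fun p q => w p * (F.mat p q * d q))]

instance : Projective F.rows :=
  (IsProjective.iff_projective (R := S) (F.ι → S)).1 inferInstance

/-- The column vector attached to a linear form. -/
noncomputable def dualVec (f : P.res.obj F.module ⟶ ModuleCat.of R R) (p : F.ι) : R :=
  -- The twist by `σ` matches the matrix `σ(G)` by which homomorphisms lift to the first terms of
  -- the resolutions.
  P.σ (f.hom (F.basisVec p))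

theorem dualVec_add (f g : P.res.obj F.module ⟶ ModuleCat.of R R) :
    F.dualVec (f + g) = F.dualVec f + F.dualVec g := by
  funext p
  exact map_add P.σ _ _

include hR

/-- A form on the quotient is a column killed by `X - A`, and left multiplication by `X - A` is
injective on columns. -/
theorem hom_eq_zero (f : F.module ⟶ ModuleCat.of S S) : f = 0 := by
  have hS := F.shortExact hR
  have : Epi F.aug := hS.epi_g
  obtain ⟨d, hd⟩ := F.col_surjective (F.aug ≫ f)
  have h0 : F.col (P.colMap F.mat d) = F.col 0 := by
    rw [← diff_comp_col, hd, ← Category.assoc, diff_aug, Limits.zero_comp]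
    refine ModuleCat.hom_ext (LinearMap.ext fun (w : F.ι → S) => ?_)
    rw [col_apply]
    simp
  have hd0 : d = 0 := (P.eq_zero_of_colMap_eq hR F.isWeighted d 0 (by
    refine (F.col_injective h0).trans ?_
    funext p
    simp)).1
  rw [← cancel_epi F.aug, ← hd, hd0, Limits.comp_zero]
  refine ModuleCat.hom_ext (LinearMap.ext fun (w : F.ι → S) => ?_)
  rw [col_apply]
  simp

theorem ext_add_two_eq_zero (n : ℕ) (x : Ext.{u} F.module (ModuleCat.of S S) (n + 2)) :
    x = 0 := by
  obtain ⟨y, rfl⟩ := Ext.contravariant_sequence_exact₃ (F.shortExact hR) (ModuleCat.of S S) x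
    (Ext.eq_zero_of_projective _) (n₀ := n + 1) (by omega)
  rw [Ext.eq_zero_of_projective y, Ext.comp_zero]

/-- The connecting map from column vectors over `R` to extensions. -/
noncomputable def colExt (u : F.ι → R) : Ext.{u} F.module (ModuleCat.of S S) 1 :=
  (F.shortExact hR).extClass.comp (Ext.mk₀ (F.col fun p => P.C (u p))) (add_zero 1)

theorem colExt_add (u v : F.ι → R) :
    F.colExt hR (u + v) = F.colExt hR u + F.colExt hR v := by
  rw [colExt, colExt, colExt, ← Ext.comp_add, ← Ext.mk₀_add, ← col_add]
  congr 3
  funext p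
  exact map_add P.C _ _

/-- The kernel of the connecting map consists of the columns divisible by `X - A`; uniqueness of
division leaves no nonzero constant among them. -/
theorem eq_zero_of_colExt_eq_zero (u : F.ι → R) (hu : F.colExt hR u = 0) : u = 0 := by
  obtain ⟨x, hx⟩ := Ext.contravariant_sequence_exact₁ (F.shortExact hR) (ModuleCat.of S S) _ _ hu
  obtain ⟨f, rfl⟩ := (Ext.mk₀_bijective _ _).2 x
  obtain ⟨d, rfl⟩ := F.col_surjective f
  change (Ext.mk₀ F.diff).comp (Ext.mk₀ (F.col d)) _ = _ at hx
  rw [Ext.mk₀_comp_mk₀, diff_comp_col] at hx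
  exact (P.eq_zero_of_colMap_eq hR F.isWeighted d u
    (F.col_injective ((Ext.mk₀_bijective _ _).1 hx))).2

/-- Every class comes from a column, by projectivity of the middle term, and the multiple of `X - A`
in its division dies under the connecting map. -/
theorem colExt_surjective : Function.Surjective (F.colExt hR) := by
  intro x
  obtain ⟨y, rfl⟩ := Ext.contravariant_sequence_exact₃ (F.shortExact hR) (ModuleCat.of S S) x
    (Ext.eq_zero_of_projective _) (n₀ := 0) (by omega)
  obtain ⟨f, rfl⟩ := (Ext.mk₀_bijective _ _).2 y
  obtain ⟨v, rfl⟩ := F.col_surjective f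
  obtain ⟨d, u, rfl⟩ := P.exists_eq_colMap_add hR F.isWeighted v
  refine ⟨u, ?_⟩
  rw [col_add, Ext.mk₀_add, Ext.comp_add]
  have h : P.colMap (fun p q => P.C (F.A p q)) d = P.colMap F.mat d := rfl
  rw [h, ← diff_comp_col, ← Ext.mk₀_comp_mk₀,
    show Ext.mk₀ F.diff = Ext.mk₀ F.complex.f from rfl,
    (F.shortExact hR).extClass_comp_assoc, zero_add]
  rfl

theorem dualVec_injective : Function.Injective F.dualVec := by
  intro f g h
  refine ModuleCat.hom_ext (LinearMap.ext fun x => ?_)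
  obtain ⟨u, hu⟩ := F.exists_eq_sum hR x
  have key : ∀ k : P.res.obj F.module ⟶ ModuleCat.of R R,
      k.hom x = ∑ p, u p * k.hom (F.basisVec p) := by
    intro k
    have : x = ∑ p, u p • (show P.res.obj F.module from F.basisVec p) := hu
    rw [this, map_sum]
    exact Finset.sum_congr rfl fun p _ => map_smul k.hom _ _
  rw [key, key]
  refine Finset.sum_congr rfl fun p _ => ?_
  rw [P.σ.injective (congrFun h p)]

theorem dualVec_surjective : Function.Surjective F.dualVec := by
  intro u
  obtain ⟨l, hl⟩ := F.exists_linearEquiv hR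
  let g : P.res.obj F.module →ₗ[R] R :=
    (Fintype.linearCombination R fun p => P.σ.symm (u p)).comp l.symm.toLinearMap
  refine ⟨ModuleCat.ofHom (X := P.res.obj F.module) g, ?_⟩
  funext p
  change P.σ (Fintype.linearCombination R (fun p => P.σ.symm (u p))
    (l.symm (show P.res.obj F.module from F.basisVec p))) = _
  have : l.symm (show P.res.obj F.module from F.basisVec p) = Pi.single p 1 := by
    rw [LinearEquiv.symm_apply_eq, hl]
    refine congrArg F.proj ?_
    funext q
    by_cases h : q = p
    · subst h; simp
    · simp [Pi.single_eq_of_ne h]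
  rw [this, Fintype.linearCombination_apply_single]
  simp

/-- The isomorphism `Hom_R(M, R) ≅ Ext¹_S(M, S)` for the module of a weighted matrix. -/
noncomputable def extEquiv :
    Ext.{u} (P.res.obj F.module) (ModuleCat.of R R) 0 ≃+
      Ext.{u} F.module (ModuleCat.of S S) 1 :=
  Ext.addEquiv₀.trans (AddEquiv.ofBijective
    (AddMonoidHom.mk' (fun f => F.colExt hR (F.dualVec f)) fun f g => by
      rw [dualVec_add, colExt_add])
    ⟨(injective_iff_map_eq_zero _).2 fun f hf => F.dualVec_injective hR (by
        refine (F.eq_zero_of_colExt_eq_zero hR _ hf).trans ?_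
        funext p
        exact (map_zero P.σ).symm),
      (F.colExt_surjective hR).comp (F.dualVec_surjective hR)⟩)

theorem extEquiv_mk₀ (f : P.res.obj F.module ⟶ ModuleCat.of R R) :
    F.extEquiv hR (Ext.mk₀ f) = F.colExt hR (F.dualVec f) := by
  have : Ext.addEquiv₀ (Ext.mk₀ f) = f := (Ext.mk₀_bijective _ _).1 (Ext.mk₀_addEquiv₀_apply _)
  change F.colExt hR (F.dualVec (Ext.addEquiv₀ (Ext.mk₀ f))) = _
  rw [this]

variable {F} {F' : P.Frame}

/-- A homomorphism between modules of weighted matrices lifts to the resolutions: a matrix `G`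
over `R` of the homomorphism and its twist `σ(G)` describe the lift. -/
theorem exists_complex_hom (c : F'.module ⟶ F.module) :
    ∃ (G : F'.ι → F.ι → R) (t : F'.complex ⟶ F.complex), t.τ₃ = c ∧
      (∀ p, c.hom (F'.basisVec p) = ∑ q, P.C (G p q) • F.basisVec q) ∧
      ∀ w : F'.ι → S, t.τ₁.hom w = fun q => ∑ p, w p * P.C (P.σ (G p q)) := by
  choose G hG using fun p => F.exists_eq_sum hR (c.hom (F'.basisVec p))
  let g (H : F'.ι → F.ι → R) : (F'.ι → S) →ₗ[S] (F.ι → S) :=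
    Fintype.linearCombination S fun p q => P.C (H p q)
  have hg : ∀ H w q, g H w q = ∑ p, w p * P.C (H p q) := by
    intro H w q
    simp only [g, Fintype.linearCombination_apply, Finset.sum_apply, Pi.smul_apply, smul_eq_mul]
  have hproj : ∀ w, F.proj (g G w) = c.hom (F'.proj w) := by
    intro w
    rw [proj_eq_sum, proj_eq_sum, map_sum]
    simp only [map_smul, hG, hg, Finset.sum_smul, Finset.smul_sum, mul_smul]
    rw [Finset.sum_comm]
  -- the defect of commutation of the left square is constant, hence zero
  have hrow : ∀ p, P.rowMap F.mat (g (fun p q => P.σ (G p q)) (Pi.single p 1)) =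
      g G (P.rowMap F'.mat (Pi.single p 1)) := by
    intro p
    rw [← sub_eq_zero]
    -- Row `p` of `σ(G)(X - A) - (X - A')G`: since `X G = σ(G) X + δ(G)`, the terms in `X` cancel
    -- and `A'G - σ(G)A - δ(G)` remains.
    let u : F.ι → R := fun q =>
      ∑ r, F'.A p r * G r q - ∑ r, P.σ (G p r) * F.A r q - P.δ (G p q)
    have hu : P.rowMap F.mat (g (fun p q => P.σ (G p q)) (Pi.single p 1)) -
        g G (P.rowMap F'.mat (Pi.single p 1)) = fun q => P.C (u q) := by
      have h1 : ∀ H q, g H (Pi.single p 1) q = P.C (H p q) := by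
        intro H q
        simp [hg, Pi.single_apply]
      have h2 : ∀ r, P.rowMap F'.mat (Pi.single p 1) r =
          (Pi.single p 1 : F'.ι → S) r * P.X - P.C (F'.A p r) := by
        intro r
        simp [rowMap_apply, Pi.single_apply, mat]
      funext q
      rw [Pi.sub_apply, rowMap_apply, hg G]
      simp only [h1, h2, sub_mul, Finset.sum_sub_distrib, mul_assoc]
      have h3 : ∑ r, (Pi.single p 1 : F'.ι → S) r * (P.X * P.C (G r q)) =
          P.C (P.σ (G p q)) * P.X + P.C (P.δ (G p q)) := by
        rw [← P.X_mul_C]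
        simp [Pi.single_apply]
      rw [h3]
      simp only [u, mat, map_sub, map_sum, map_mul]
      abel
    have hu0 : u = 0 := F.eq_zero_of_proj_C_eq_zero hR u (by
      rw [← hu, map_sub, hproj, (F.proj_eq_zero_iff _).2 ⟨_, rfl⟩,
        (F'.proj_eq_zero_iff _).2 ⟨_, rfl⟩, map_zero, sub_zero])
    rw [hu, hu0]
    funext q
    simp
  refine ⟨G, ⟨ModuleCat.ofHom (g fun p q => P.σ (G p q)), ModuleCat.ofHom (g G), c, ?_, ?_⟩, rfl,
    hG, fun w => funext fun q => hg _ w q⟩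
  · exact ModuleCat.hom_ext (LinearMap.pi_ext' fun p => LinearMap.ext_ring (hrow p))
  · exact ModuleCat.hom_ext (LinearMap.ext hproj)

/-- Naturality of the extension class along the lifted map of resolutions reduces the claim to an
identity of columns, `σ(G f) = σ(G) σ(f)`. -/
theorem extEquiv_naturality (c : F'.module ⟶ F.module)
    (x : Ext.{u} (P.res.obj F.module) (ModuleCat.of R R) 0) :
    F'.extEquiv hR ((Ext.mk₀ (P.res.map c)).comp x (zero_add 0)) =
      (Ext.mk₀ c).comp (F.extEquiv hR x) (zero_add 1) := by
  obtain ⟨f, rfl⟩ := (Ext.mk₀_bijective _ _).2 x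
  obtain ⟨G, t, ht₃, hG, ht₁⟩ := exists_complex_hom hR c
  rw [Ext.mk₀_comp_mk₀, extEquiv_mk₀, extEquiv_mk₀, colExt, colExt, ← Ext.comp_assoc_of_third_deg_zero,
    ← ht₃, ← ShortComplex.ShortExact.extClass_naturality (F'.shortExact hR) (F.shortExact hR) t,
    Ext.comp_assoc_of_third_deg_zero, Ext.mk₀_comp_mk₀]
  congr 2
  refine ModuleCat.hom_ext (LinearMap.ext fun (w : F'.ι → S) => ?_)
  have h1 : (t.τ₁ ≫ F.col fun p => P.C (F.dualVec f p)).hom w =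
      ∑ q, (∑ p, w p * P.C (P.σ (G p q))) * P.C (F.dualVec f q) := by
    rw [ModuleCat.hom_comp, LinearMap.comp_apply, ht₁, col_apply]
  rw [h1, col_apply]
  have h2 : ∀ p, F'.dualVec (P.res.map t.τ₃ ≫ f) p = ∑ q, P.σ (G p q) * F.dualVec f q := by
    intro p
    have : f.hom (∑ q, G p q • (show P.res.obj F.module from F.basisVec q)) =
        ∑ q, G p q * f.hom (F.basisVec q) := by
      rw [map_sum]
      exact Finset.sum_congr rfl fun q _ => map_smul f.hom _ _
    change P.σ (f.hom (t.τ₃.hom (F'.basisVec p))) = _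
    rw [ht₃, hG]
    refine (congrArg P.σ this).trans ?_
    simp only [map_sum, map_mul]
    rfl
  simp only [h2, map_sum, map_mul, Finset.mul_sum, Finset.sum_mul, mul_assoc]
  rw [Finset.sum_comm]

end LocalSkewPowerSeriesRing.Frame

/-! ### Comparison of kernels and cokernels, and exactness for `Ext`. -/

section Groups

/-- An isomorphism of the kernels of two maps, from compatible isomorphisms of the groups. -/
theorem AddMonoidHom.exists_addEquiv_of_exact {A B C A' B' C' : Type*} [AddCommGroup A]
    [AddCommGroup B] [AddCommGroup C] [AddCommGroup A'] [AddCommGroup B'] [AddCommGroup C']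
    (f : A →+ B) (g : B →+ C) (f' : A' →+ B') (g' : B' →+ C')
    (hf : Function.Injective f) (hf' : Function.Injective f')
    (h : Function.Exact f g) (h' : Function.Exact f' g') (φ : B ≃+ B') (ψ : C ≃+ C')
    (comm : ∀ b, ψ (g b) = g' (φ b)) : ∃ e : A ≃+ A', ∀ a, f' (e a) = φ (f a) := by
  have hex : ∀ a, ∃ a', f' a' = φ (f a) := fun a => (h' _).1 (by
    rw [← comm, (h _).2 ⟨a, rfl⟩, map_zero])
  choose e he using hex
  let E : A →+ A' := AddMonoidHom.mk' e fun a b => hf' (by simp only [map_add, he])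
  refine ⟨AddEquiv.ofBijective E ⟨fun a b hab => ?_, fun a' => ?_⟩, he⟩
  · have hab' : e a = e b := hab
    exact hf (φ.injective (by rw [← he, ← he, hab']))
  · obtain ⟨a, ha⟩ := (h (φ.symm (f' a'))).1 (ψ.injective (by
      rw [comm, AddEquiv.apply_symm_apply, map_zero, (h' _).2 ⟨a', rfl⟩]))
    refine ⟨a, hf' ?_⟩
    change f' (e a) = _
    rw [he, ha, AddEquiv.apply_symm_apply]

/-- An isomorphism of the cokernels of two maps, from compatible isomorphisms of the groups. -/
theorem AddMonoidHom.nonempty_addEquiv_of_exact {A B C A' B' C' : Type*} [AddCommGroup A]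
    [AddCommGroup B] [AddCommGroup C] [AddCommGroup A'] [AddCommGroup B'] [AddCommGroup C']
    (f : A →+ B) (g : B →+ C) (f' : A' →+ B') (g' : B' →+ C')
    (hg : Function.Surjective g) (hg' : Function.Surjective g')
    (h : Function.Exact f g) (h' : Function.Exact f' g') (φ : A ≃+ A') (ψ : B ≃+ B')
    (comm : ∀ a, ψ (f a) = f' (φ a)) : Nonempty (C ≃+ C') := by
  have key : g.ker.map ψ.toAddMonoidHom = g'.ker := by
    ext y
    constructor
    · rintro ⟨x, hx, rfl⟩
      obtain ⟨a, rfl⟩ := (h x).1 hx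
      exact (h' _).2 ⟨φ a, (comm a).symm⟩
    · intro hy
      obtain ⟨a', rfl⟩ := (h' y).1 hy
      refine ⟨f (φ.symm a'), (h _).2 ⟨_, rfl⟩, ?_⟩
      exact (comm _).trans (by rw [AddEquiv.apply_symm_apply])
  exact ⟨(QuotientAddGroup.quotientKerEquivOfSurjective g hg).symm.trans
    ((QuotientAddGroup.congr _ _ ψ key).trans
      (QuotientAddGroup.quotientKerEquivOfSurjective g' hg'))⟩

end Groups

section Ext

variable {C : Type*} [Category.{v} C] [Abelian C] [HasExt.{u} C]

/-- Dimension shifting. -/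
theorem CategoryTheory.ShortComplex.ShortExact.nonempty_ext_addEquiv {T : ShortComplex C}
    (hT : T.ShortExact) (Y : C) (n : ℕ) (h0 : ∀ x : Ext.{u} T.X₂ Y n, x = 0)
    (h1 : ∀ x : Ext.{u} T.X₂ Y (n + 1), x = 0) :
    Nonempty (Ext.{u} T.X₁ Y n ≃+ Ext.{u} T.X₃ Y (n + 1)) := by
  refine ⟨AddEquiv.ofBijective (hT.extClass.precomp Y (add_comm 1 n)) ⟨?_, fun x => ?_⟩⟩
  · rw [injective_iff_map_eq_zero]
    intro x hx
    obtain ⟨y, rfl⟩ := Ext.contravariant_sequence_exact₁ hT Y x (add_comm 1 n) hx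
    rw [h0 y, Ext.comp_zero]
  · exact Ext.contravariant_sequence_exact₃ hT Y x (h1 _) (add_comm 1 n)

/-- Left exactness of a contravariant `Ext` functor that is injective on two epimorphisms of a
presentation. -/
theorem CategoryTheory.Abelian.Ext.precomp_exact_of_injective {T : ShortComplex C}
    (hT : T.ShortExact) {Z : C} (p : Z ⟶ T.X₁) (Y : C) (n : ℕ)
    (hp : Function.Injective ((Ext.mk₀ p).precomp Y (zero_add n))) :
    Function.Exact ((Ext.mk₀ T.g).precomp Y (zero_add n))
      ((Ext.mk₀ (p ≫ T.f)).precomp Y (zero_add n)) := by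
  intro x
  constructor
  · intro hx
    refine Ext.contravariant_sequence_exact₂ hT Y x (hp ?_)
    change (Ext.mk₀ p).comp ((Ext.mk₀ T.f).comp x (zero_add n)) (zero_add n) = _
    rw [map_zero, Ext.mk₀_comp_mk₀_assoc]
    exact hx
  · rintro ⟨y, rfl⟩
    change (Ext.mk₀ (p ≫ T.f)).comp ((Ext.mk₀ T.g).comp y (zero_add n)) (zero_add n) = 0
    rw [Ext.mk₀_comp_mk₀_assoc, Category.assoc, T.zero, Limits.comp_zero, Ext.mk₀_zero,
      Ext.zero_comp]

end Ext

/-! ### From modules of weighted matrices to arbitrary modules finite over `R`. -/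

namespace LocalSkewPowerSeriesRing

variable {R S : Type u} [Ring R] [Ring S] {m : Ideal R} [m.IsTwoSided]
  (P : LocalSkewPowerSeriesRing m S) (hR : IsCompleteLocal m)

theorem shortExact_map_res {T : ShortComplex (ModuleCat.{u} S)} (hT : T.ShortExact) :
    (T.map P.res).ShortExact :=
  ModuleCat.shortComplex_shortExact _
    ((ShortComplex.ShortExact.moduleCat_exact_iff_function_exact T).1 hT.exact)
    hT.moduleCat_injective_f hT.moduleCat_surjective_g

include hR

/-- A module that is finitely generated over `R` is a quotient of the module of a weighted matrix,
and the kernel is finitely generated over `R`. -/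
theorem exists_frame_shortExact [IsNoetherianRing R] (M : ModuleCat.{u} S)
    (hM : Module.Finite R (P.res.obj M)) :
    ∃ (F : P.Frame) (K : ModuleCat.{u} S) (f : K ⟶ F.module) (g : F.module ⟶ M)
      (w : f ≫ g = 0), (ShortComplex.mk f g w).ShortExact ∧ Module.Finite R (P.res.obj K) := by
  let _ : Module R M := Module.compHom M P.C
  have : Module.Finite R M := hM
  obtain ⟨ι, _, _, e, A, h, n, hA, he, hX⟩ :=
    P.exists_weighted_generators hR (M := M) (fun _ _ => rfl)
  let F : P.Frame := ⟨ι, A, h, n, hA⟩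
  let g : F.module ⟶ M := F.desc M e hX
  have hg : Function.Surjective g.hom := by
    intro x
    have hx : x ∈ Submodule.span R (Set.range e) := he ▸ trivial
    obtain ⟨c, rfl⟩ := (Submodule.mem_span_range_iff_exists_fun R).1 hx
    exact ⟨F.proj fun p => P.C (c p), F.desc_proj M e hX _⟩
  have hse := LinearMap.shortExact_shortComplexKer hg
  refine ⟨F, _, _, _, _, hse, ?_⟩
  have := F.finite hR
  have : IsNoetherian R (P.res.obj F.module) := isNoetherian_of_isNoetherianRing_of_finite R _
  exact Module.Finite.of_injective (P.res.map (g.hom.shortComplexKer.f)).hom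
    hse.moduleCat_injective_f

variable [IsNoetherianRing R]

theorem hom_eq_zero_of_finite (M : ModuleCat.{u} S) (hM : Module.Finite R (P.res.obj M))
    (f : M ⟶ ModuleCat.of S S) : f = 0 := by
  obtain ⟨F, K, i, π, w, hT, -⟩ := P.exists_frame_shortExact hR M hM
  have : Epi π := hT.epi_g
  rw [← cancel_epi π, F.hom_eq_zero hR (π ≫ f), Limits.comp_zero]

theorem ext_zero_eq_zero (M : ModuleCat.{u} S) (hM : Module.Finite R (P.res.obj M))
    (x : Ext.{u} M (ModuleCat.of S S) 0) : x = 0 := by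
  obtain ⟨f, rfl⟩ := (Ext.mk₀_bijective _ _).2 x
  rw [P.hom_eq_zero_of_finite hR M hM f, Ext.mk₀_zero]

/-- The kernel is a quotient of `Hom_S(T.X₁, S)`, which vanishes as `T.X₁` is finite over `R`. -/
theorem precomp_ext_one_injective {T : ShortComplex (ModuleCat.{u} S)} (hT : T.ShortExact)
    (hK : Module.Finite R (P.res.obj T.X₁)) :
    Function.Injective ((Ext.mk₀.{u} T.g).precomp (ModuleCat.of S S) (zero_add 1)) := by
  rw [injective_iff_map_eq_zero]
  intro x hx
  obtain ⟨y, rfl⟩ := Ext.contravariant_sequence_exact₃ hT _ x hx (n₀ := 0) rfl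
  rw [P.ext_zero_eq_zero hR _ hK y, Ext.comp_zero]

/-- The isomorphism `Hom_R(M, R) ≅ Ext¹_S(M, S)`, compatible with homomorphisms to modules of
weighted matrices. -/
theorem exists_extEquiv (M : ModuleCat.{u} S) (hM : Module.Finite R (P.res.obj M)) :
    ∃ φ : Ext.{u} (P.res.obj M) (ModuleCat.of R R) 0 ≃+ Ext.{u} M (ModuleCat.of S S) 1,
      ∀ (F : P.Frame) (c : M ⟶ F.module) (x : Ext.{u} (P.res.obj F.module) (ModuleCat.of R R) 0),
        φ ((Ext.mk₀ (P.res.map c)).comp x (zero_add 0)) =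
          (Ext.mk₀ c).comp (F.extEquiv hR x) (zero_add 1) := by
  -- A presentation `F₂ → F₁ → M → 0`. Both `Hom_R(-, R)` and `Ext¹_S(-, S)` turn it into a left
  -- exact sequence, so the isomorphisms for `F₁` and `F₂` induce one for `M` on kernels.
  obtain ⟨F₁, K₁, i₁, π₁, w₁, hT₁, hK₁⟩ := P.exists_frame_shortExact hR M hM
  obtain ⟨F₂, K₂, i₂, π₂, w₂, hT₂, hK₂⟩ := P.exists_frame_shortExact hR K₁ hK₁
  have hT₁' := P.shortExact_map_res hT₁
  have hT₂' := P.shortExact_map_res hT₂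
  have e₁ : Epi (P.res.map π₁) := hT₁'.epi_g
  have e₂ : Epi (P.res.map π₂) := hT₂'.epi_g
  have injR₁ : Function.Injective
      ((Ext.mk₀.{u} (P.res.map π₁)).precomp (ModuleCat.of R R) (zero_add 0)) :=
    Ext.precomp_mk₀_injective_of_epi _ _
  have injR₂ : Function.Injective
      ((Ext.mk₀.{u} (P.res.map π₂)).precomp (ModuleCat.of R R) (zero_add 0)) :=
    Ext.precomp_mk₀_injective_of_epi _ _
  have inj₁ : Function.Injective
      ((Ext.mk₀.{u} π₁).precomp (ModuleCat.of S S) (zero_add 1)) :=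
    P.precomp_ext_one_injective hR (T := ShortComplex.mk i₁ π₁ w₁) hT₁ hK₁
  have inj₂ : Function.Injective
      ((Ext.mk₀.{u} π₂).precomp (ModuleCat.of S S) (zero_add 1)) :=
    P.precomp_ext_one_injective hR (T := ShortComplex.mk i₂ π₂ w₂) hT₂ hK₂
  have exR : Function.Exact
      ((Ext.mk₀.{u} (P.res.map π₁)).precomp (ModuleCat.of R R) (zero_add 0))
      ((Ext.mk₀.{u} (P.res.map π₂ ≫ P.res.map i₁)).precomp (ModuleCat.of R R) (zero_add 0)) :=
    Ext.precomp_exact_of_injective hT₁' (P.res.map π₂) _ 0 injR₂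
  have exS : Function.Exact
      ((Ext.mk₀.{u} π₁).precomp (ModuleCat.of S S) (zero_add 1))
      ((Ext.mk₀.{u} (π₂ ≫ i₁)).precomp (ModuleCat.of S S) (zero_add 1)) :=
    Ext.precomp_exact_of_injective (T := ShortComplex.mk i₁ π₁ w₁) hT₁ π₂ _ 1 inj₂
  rw [← Functor.map_comp] at exR
  obtain ⟨φ, hφ⟩ := AddMonoidHom.exists_addEquiv_of_exact _ _ _ _ injR₁ inj₁ exR exS
    (F₁.extEquiv hR) (F₂.extEquiv hR) (Frame.extEquiv_naturality hR (π₂ ≫ i₁))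
  have hφ' : ∀ a : Ext.{u} (P.res.obj M) (ModuleCat.of R R) 0,
      (Ext.mk₀ π₁).comp (φ a) (zero_add 1) =
        F₁.extEquiv hR ((Ext.mk₀ (P.res.map π₁)).comp a (zero_add 0)) := hφ
  refine ⟨φ, fun F c x => ?_⟩
  -- Compatibility with `c` can be tested after pulling back along `π₁`, where it is naturality for
  -- the composite `F₁ → F`.
  have key : (Ext.mk₀ π₁).comp (φ ((Ext.mk₀ (P.res.map c)).comp x (zero_add 0))) (zero_add 1) =
      (Ext.mk₀ π₁).comp ((Ext.mk₀ c).comp (F.extEquiv hR x) (zero_add 1)) (zero_add 1) := by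
    rw [hφ', Ext.mk₀_comp_mk₀_assoc, Ext.mk₀_comp_mk₀_assoc, ← Functor.map_comp,
      Frame.extEquiv_naturality]
  exact inj₁ key

/-- Plain dimension shifting fails here, as `Hom_R(F, R)` and `Ext¹_S(F, S)` need not vanish. Both
groups are cokernels of restriction from `F` to the kernel `K`, and these restrictions correspond by
the compatibility in `exists_extEquiv`. -/
theorem nonempty_ext_one_addEquiv (M : ModuleCat.{u} S) (hM : Module.Finite R (P.res.obj M)) :
    Nonempty (Ext.{u} (P.res.obj M) (ModuleCat.of R R) 1 ≃+
      Ext.{u} M (ModuleCat.of S S) 2) := by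
  obtain ⟨F, K, i, π, w, hT, hK⟩ := P.exists_frame_shortExact hR M hM
  have hT' := P.shortExact_map_res hT
  have : Projective (P.res.obj F.module) := F.projective hR
  obtain ⟨φ, hφ⟩ := P.exists_extEquiv hR K hK
  refine AddMonoidHom.nonempty_addEquiv_of_exact
    ((Ext.mk₀ (P.res.map i)).precomp (ModuleCat.of R R) (zero_add 0))
    (hT'.extClass.precomp (ModuleCat.of R R) (add_zero 1))
    ((Ext.mk₀ i).precomp (ModuleCat.of S S) (zero_add 1))
    (hT.extClass.precomp (ModuleCat.of S S) (rfl : 1 + 1 = 2))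
    (fun x => Ext.contravariant_sequence_exact₃ hT' _ x
      (Ext.eq_zero_of_projective (P := P.res.obj F.module) _) (add_zero 1))
    (fun x => Ext.contravariant_sequence_exact₃ hT _ x (F.ext_add_two_eq_zero hR 0 _) rfl)
    (fun x => ⟨fun hx => Ext.contravariant_sequence_exact₁ hT' _ x (add_zero 1) hx, ?_⟩)
    (fun x => ⟨fun hx => Ext.contravariant_sequence_exact₁ hT _ x rfl hx, ?_⟩)
    (F.extEquiv hR) φ (hφ F i)
  · rintro ⟨y, rfl⟩
    exact hT'.extClass_comp_assoc y (h := add_zero 1)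
  · rintro ⟨y, rfl⟩
    exact hT.extClass_comp_assoc y (h := rfl)

/-- From degree two on both sides shift to `K`: `Ext_R(F, R)` vanishes in positive degrees and
`Ext_S(F, S)` from degree two. -/
theorem nonempty_ext_addEquiv (i : ℕ) : ∀ M : ModuleCat.{u} S, Module.Finite R (P.res.obj M) →
    Nonempty (Ext.{u} (P.res.obj M) (ModuleCat.of R R) i ≃+
      Ext.{u} M (ModuleCat.of S S) (i + 1)) := by
  induction i with
  | zero => exact fun M hM => ⟨(P.exists_extEquiv hR M hM).choose⟩
  | succ i ih =>
    intro M hM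
    cases i with
    | zero => exact P.nonempty_ext_one_addEquiv hR M hM
    | succ i =>
      obtain ⟨F, K, f, π, w, hT, hK⟩ := P.exists_frame_shortExact hR M hM
      have : Projective (P.res.obj F.module) := F.projective hR
      obtain ⟨φ⟩ := ih K hK
      obtain ⟨α⟩ := (P.shortExact_map_res hT).nonempty_ext_addEquiv (ModuleCat.of R R) (i + 1)
        (fun _ => Ext.eq_zero_of_projective (P := P.res.obj F.module) _)
        (fun _ => Ext.eq_zero_of_projective (P := P.res.obj F.module) _)
      obtain ⟨β⟩ := hT.nonempty_ext_addEquiv (ModuleCat.of S S) (i + 2)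
        (F.ext_add_two_eq_zero hR i) (F.ext_add_two_eq_zero hR (i + 1))
      exact ⟨α.symm.trans (φ.trans β)⟩

end LocalSkewPowerSeriesRing

theorem mainTheorem6 {R S : Type u} [Ring R] [Ring S] [IsNoetherianRing R]
    (m : Ideal R) [m.IsTwoSided] (hR : IsCompleteLocal m)
    (P : LocalSkewPowerSeriesRing m S)
    (M : ModuleCat.{u} S)
    (hM : Module.Finite R ((ModuleCat.restrictScalars P.C).obj M)) :
    (∀ i : ℕ, Nonempty
      (CategoryTheory.Abelian.Ext.{u} ((ModuleCat.restrictScalars P.C).obj M)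
          (ModuleCat.of R R) i ≃+
        CategoryTheory.Abelian.Ext.{u} M (ModuleCat.of S S) (i + 1))) ∧
    Subsingleton (CategoryTheory.Abelian.Ext.{u} M (ModuleCat.of S S) 0) :=
  ⟨fun i => P.nonempty_ext_addEquiv hR i M hM,
    ⟨fun x y => by rw [P.ext_zero_eq_zero hR M hM x, P.ext_zero_eq_zero hR M hM y]⟩⟩
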